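/- Let $n,k,r,s$ be integers with $r\ge 1$, and let $\mathcal H$ be an $r$-uniform hypergraph on $n$ vertices whose matching number $\nu(\mathcal H)$ (the maximum number of pairwise disjoint edges) is at most $k$. For $s\ge r$ let $K^r_s(\mathcal H)$ denote the number of $s$-cliques of $\mathcal H$, i.e. of $s$-element vertex sets all of whose $r$-element subsets are edges of $\mathcal H$. For $1\le a\le r$ let $$\mathcal F^{(r)}_{n,k,a}=\Big\{F\in\tbinom{[n]}{r} : |F\cap[ak+a-1]|\ge a\Big\},$$ an $r$-uniform hypergraph on the vertex set $[n]=\{1,\dots,n\}$. Then $\nu(\mathcal F^{(r)}_{n,k,a})\le k$ for all $1\le a\le r$, and the following hold. (I) If $r\le s\le k+r-1$ and $n\ge 4(er)^{s-r+2}k$, then $K^r_s(\mathcal H)\le K^r_s(\mathcal F^{(r)}_{n,k,1})$. (II) If $k+r\le s\le (r-1)(k+1)$ and $n\ge 4r^2k\left(\frac{er}{a-1}\right)^{s-r+a}$, where $a=\left\lfloor\frac{s-r}{k}\right\rfloor+1$, then $K^r_s(\mathcal H)\le K^r_s(\mathcal F^{(r)}_{n,k,a})$. (III) If $(r-1)k+r\le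 s\le rk+r-1$ and $n\ge rk+r-1$, then $K^r_s(\mathcal H)\le K^r_s(\mathcal F^{(r)}_{n,k,r})$. Moreover, if $K^r_s(\mathcal H)<K^r_s(\mathcal F^{(r)}_{n,k,r})$, then $$K^r_s(\mathcal H)\le \binom{rk+r-1}{s}-\binom{rk-1}{s-r}.$$ -/

import Mathlib

/-! An `r`-graph on a finite vertex type `V` is given by its edge set, a finset `H` of finsets of
vertices all of which have exactly `r` elements: `(H : Set (Finset V)).Sized r`. -/

namespace CliqueMatching

/-- The matching number: the largest number of pairwise disjoint edges of `H`. -/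
def matchingNumber {V : Type*} [DecidableEq V] (H : Finset (Finset V)) : ℕ :=
  (H.powerset.filter fun M => ∀ A ∈ M, ∀ B ∈ M, A ≠ B → Disjoint A B).sup Finset.card

/-- The (vertex sets of the) `s`-cliques of an `r`-graph `H`: the `s`-element vertex sets all of
whose `r`-element subsets are edges. -/
def cliques {V : Type*} [Fintype V] [DecidableEq V] (r s : ℕ) (H : Finset (Finset V)) :
    Finset (Finset V) :=
  ((Finset.univ : Finset V).powersetCard s).filter fun K => K.powersetCard r ⊆ H

/-- The number of `s`-cliques of an `r`-graph `H`. -/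
def cliqueCount {V : Type*} [Fintype V] [DecidableEq V] (r s : ℕ) (H : Finset (Finset V)) : ℕ :=
  (cliques r s H).card

/-- The `r`-graph on `n` vertices whose edges are the `r`-element sets that contain at least `a`
of the first `a * k + a - 1` vertices (to be used for `1 ≤ a`). -/
def extremal (r n k a : ℕ) : Finset (Finset (Fin n)) :=
  ((Finset.univ : Finset (Fin n)).powersetCard r).filter fun F =>
    a ≤ (F.filter fun i => i.val < a * k + a - 1).card

end CliqueMatching

namespace CliqueMatching
open Finset

/-! Write t = s - r and label the vertices 0, ..., n - 1. A shift (replace j by a smaller i wherever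
possible) keeps edge sizes, creates no matching of k + 1 edges and does not decrease the number of
s-cliques. So the upper bounds need only be proved for families closed under moving elements down.

The basic fact about such a family is `exists_le_cnt_of_clique`: each s-clique K has, for some i
with 1 ≤ i ≤ r, at least t + i elements below i(k + 1) - 1. Otherwise the r largest elements of K
lie so high that their edge can be pushed down onto k + 1 disjoint sets, one in each residue class
mod k + 1. Counting forces ik > t, so i ≥ a with a = ⌊t/k⌋ + 1; the cliques of the extremal graph
are governed by i = a.

(III) If t ≥ (r - 1)k then i = r, so K lies in the first rk + r - 1 vertices. Stability: either the
last r of these vertices form an edge, and the graph on them is complete, or every s-set containing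
those r vertices is lost. For k ≥ 2, completeness on rk + r - 1 vertices can be pulled back through
shifts (`exists_complete_of_shift`).

(II) Consider the edge W made of the last a core vertices and r - a far ones. If it is present, a
clique with fewer than t + a core vertices would yield k + 1 disjoint edges (`le_cnt_of_far_mem`).
If it is absent, a family G of s-sets which are cliques of the extremal graph is lost, and for large
n this outweighs all cliques having i > a, a geometric sum.

(I) Here a = 1, and n is only linear in k while k/t is unbounded, so losing one such family is not
enough. The proof uses the edge consisting of one vertex x ≤ t and r - 1 far vertices. If it is
absent, every clique carries an additional excess and is rare (`card_cl_le_of_far_notMem`). If it is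
present with x = 0, deleting vertex 0 lowers k by one (`matchFree_down`), and Pascal's rule drives
an induction on k; at t + 1 = k the vertex x = t is used with `le_cnt_of_far_mem`. -/

/-- The number of elements of `E` below `m`. -/
abbrev cnt (E : Finset ℕ) (m : ℕ) : ℕ := (E.filter (· < m)).card

/-- A family of finite sets of naturals closed under decreasing elements. -/
def DownClosed (H : Set (Finset ℕ)) : Prop :=
  ∀ E ∈ H, ∀ E' : Finset ℕ, E'.card = E.card → (∀ m, cnt E m ≤ cnt E' m) → E' ∈ H

/-- `H` has no `k + 1` pairwise disjoint members. -/
def MatchFree (k : ℕ) (H : Set (Finset ℕ)) : Prop :=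
  ∀ f : ℕ → Finset ℕ, (∀ i ≤ k, f i ∈ H) →
    (∀ i ≤ k, ∀ j ≤ k, i ≠ j → Disjoint (f i) (f j)) → False

open Classical in
/-- The `s`-subsets of `range n` all of whose `r`-subsets belong to `H`. -/
noncomputable def cl (r n s : ℕ) (H : Set (Finset ℕ)) : Finset (Finset ℕ) :=
  ((range n).powersetCard s).filter fun K => ∀ E ⊆ K, E.card = r → E ∈ H

lemma mem_cl {r n s : ℕ} {H : Set (Finset ℕ)} {K : Finset ℕ} :
    K ∈ cl r n s H ↔ K ⊆ range n ∧ K.card = s ∧ ∀ E ⊆ K, E.card = r → E ∈ H := by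
  simp [cl, mem_powersetCard, and_assoc]

/-! ### Shifting -/

/-- The image of a set under the transposition of `i` and `j`. -/
def swapSet (i j : ℕ) (E : Finset ℕ) : Finset ℕ := E.map (Equiv.swap i j).toEmbedding

lemma mem_swapSet {i j x : ℕ} {E : Finset ℕ} : x ∈ swapSet i j E ↔ Equiv.swap i j x ∈ E := by
  simp [swapSet, mem_map_equiv]

lemma swapSet_swapSet (i j : ℕ) (E : Finset ℕ) : swapSet i j (swapSet i j E) = E := by
  ext x; simp [mem_swapSet]

lemma card_swapSet (i j : ℕ) (E : Finset ℕ) : (swapSet i j E).card = E.card := card_map _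

lemma swapSet_subset {i j : ℕ} {E F : Finset ℕ} (h : E ⊆ F) : swapSet i j E ⊆ swapSet i j F :=
  map_subset_map.2 h

lemma left_mem_swapSet {i j : ℕ} {E : Finset ℕ} : i ∈ swapSet i j E ↔ j ∈ E := by
  simp [mem_swapSet]

lemma right_mem_swapSet {i j : ℕ} {E : Finset ℕ} : j ∈ swapSet i j E ↔ i ∈ E := by
  simp [mem_swapSet]

lemma mem_swapSet_of_ne {i j x : ℕ} {E : Finset ℕ} (hi : x ≠ i) (hj : x ≠ j) :
    x ∈ swapSet i j E ↔ x ∈ E := by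
  rw [mem_swapSet, Equiv.swap_apply_of_ne_of_ne hi hj]

lemma swapSet_eq_self {i j : ℕ} {E : Finset ℕ} (h : i ∈ E ↔ j ∈ E) : swapSet i j E = E := by
  ext x
  by_cases hi : x = i
  · subst hi; rw [left_mem_swapSet, h]
  by_cases hj : x = j
  · subst hj; rw [right_mem_swapSet, h]
  exact mem_swapSet_of_ne hi hj

lemma swapSet_eq_insert {i j : ℕ} {E : Finset ℕ} (hj : j ∈ E) (hi : i ∉ E) :
    swapSet i j E = insert i (E.erase j) := by
  have hij : i ≠ j := fun h => hi (h ▸ hj)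
  ext x
  by_cases hxi : x = i
  · subst hxi; simp [left_mem_swapSet, hj]
  by_cases hxj : x = j
  · subst hxj; simp [right_mem_swapSet, hi, hij.symm]
  simp [mem_swapSet_of_ne hxi hxj, hxi, hxj]

/-- The action of the shift on a member of `H`. -/
def shiftMap (i j : ℕ) (H : Finset (Finset ℕ)) (E : Finset ℕ) : Finset ℕ :=
  if j ∈ E ∧ i ∉ E ∧ swapSet i j E ∉ H then swapSet i j E else E

/-- The shift of `H` that replaces `j` by `i` where possible. -/
def shift (i j : ℕ) (H : Finset (Finset ℕ)) : Finset (Finset ℕ) := H.image (shiftMap i j H)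

lemma shiftMap_injOn (i j : ℕ) (H : Finset (Finset ℕ)) :
    Set.InjOn (shiftMap i j H) (H : Set (Finset ℕ)) := by
  intro E hE F hF h
  simp only [mem_coe] at hE hF
  unfold shiftMap at h
  split_ifs at h with h1 h2 h2
  · rw [← swapSet_swapSet i j E, h, swapSet_swapSet]
  · exact absurd (h ▸ hF) h1.2.2
  · exact absurd (h ▸ hE) h2.2.2
  · exact h

/-- Membership in a shift. -/
lemma mem_shift {i j : ℕ} {H : Finset (Finset ℕ)} {E : Finset ℕ} :
    E ∈ shift i j H ↔ (E ∈ H ∧ (j ∈ E → i ∉ E → swapSet i j E ∈ H)) ∨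
      (i ∈ E ∧ j ∉ E ∧ E ∉ H ∧ swapSet i j E ∈ H) := by
  unfold shift shiftMap
  rw [mem_image]
  constructor
  · rintro ⟨F, hF, rfl⟩
    split_ifs with h
    · right
      rw [left_mem_swapSet, right_mem_swapSet, swapSet_swapSet]
      exact ⟨h.1, h.2.1, h.2.2, hF⟩
    · left
      exact ⟨hF, fun h1 h2 => by_contra fun h3 => h ⟨h1, h2, h3⟩⟩
  · rintro (⟨h1, h2⟩ | ⟨h1, h2, h3, h4⟩)
    · exact ⟨E, h1, if_neg fun h => h.2.2 (h2 h.1 h.2.1)⟩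
    · refine ⟨swapSet i j E, h4, ?_⟩
      rw [if_pos ⟨right_mem_swapSet.2 h1, fun h => h2 (left_mem_swapSet.1 h),
        by rwa [swapSet_swapSet]⟩, swapSet_swapSet]

lemma card_of_mem_shift {i j r : ℕ} {H : Finset (Finset ℕ)} (hH : ∀ E ∈ H, E.card = r) :
    ∀ E ∈ shift i j H, E.card = r := by
  intro E hE
  rcases mem_shift.1 hE with h | h
  · exact hH _ h.1
  · rw [← card_swapSet i j]; exact hH _ h.2.2.2

/-- Among disjoint sets only one can contain i, so at most one is new. If there is a new one,
interchanging i and j in all the sets gives disjoint members of the original family: the old sets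
containing j have their swap in `H`, and those avoiding both points do not change. -/
lemma matchFree_shift {i j k : ℕ} {H : Finset (Finset ℕ)} (hH : MatchFree k (H : Set (Finset ℕ))) :
    MatchFree k (shift i j H : Set (Finset ℕ)) := by
  intro f hf hd
  by_cases hall : ∀ l ≤ k, f l ∈ H
  · exact hH f hall hd
  push Not at hall
  obtain ⟨l₀, hl₀, hbad⟩ := hall
  have h₀ : i ∈ f l₀ ∧ j ∉ f l₀ ∧ f l₀ ∉ H ∧ swapSet i j (f l₀) ∈ H := by
    rcases mem_shift.1 (hf l₀ hl₀) with h | h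
    · exact absurd h.1 hbad
    · exact h
  refine hH (fun l => swapSet i j (f l)) (fun l hl => ?_) (fun l hl m hm hlm => ?_)
  · by_cases hll : l = l₀
    · subst hll; exact h₀.2.2.2
    have hi : i ∉ f l := fun h => (Finset.disjoint_left.1 (hd l hl l₀ hl₀ hll)) h h₀.1
    rcases mem_shift.1 (hf l hl) with h | h
    · by_cases hj : j ∈ f l
      · exact h.2 hj hi
      · show swapSet i j (f l) ∈ H
        rw [swapSet_eq_self (by simp [hi, hj])]; exact h.1
    · exact absurd h.1 hi
  · exact (Finset.disjoint_map _).2 (hd l hl m hm hlm)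

/-- Together with injectivity of the shift this shows that shifting loses no cliques. For a clique
that stays, a swapped r-subset lies either in the same clique (i ∈ K) or in its swap, also a clique.
For a set K that is new, the swaps of its r-subsets lie in an old clique. -/
lemma shift_cl_subset {r n s i j : ℕ} (hij : i < j) {H : Finset (Finset ℕ)} :
    shift i j (cl r n s H) ⊆ cl r n s (shift i j H : Set (Finset ℕ)) := by
  intro K hK
  rw [mem_cl]
  rcases mem_shift.1 hK with ⟨h1, h2⟩ | ⟨hi, hj, h3, h4⟩
  · obtain ⟨hn, hc, hE⟩ := mem_cl.1 h1
    refine ⟨hn, hc, fun E hEK hEr => ?_⟩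
    rw [mem_coe, mem_shift]
    refine Or.inl ⟨hE E hEK hEr, fun hj hi => ?_⟩
    by_cases hiK : i ∈ K
    · refine hE _ ?_ (by rw [card_swapSet, hEr])
      rw [swapSet_eq_insert hj hi]
      exact insert_subset hiK ((erase_subset _ _).trans hEK)
    · exact (mem_cl.1 (h2 (hEK hj) hiK)).2.2 _ (swapSet_subset hEK) (by rw [card_swapSet, hEr])
  · obtain ⟨hn, hc, hE⟩ := mem_cl.1 h4
    have hjn : j < n := mem_range.1 (hn (right_mem_swapSet.2 hi))
    refine ⟨fun x hx => ?_, by rw [← hc, card_swapSet], fun E hEK hEr => ?_⟩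
    · by_cases hxi : x = i
      · subst hxi; exact mem_range.2 (hij.trans hjn)
      · have hxj : x ≠ j := fun h => hj (h ▸ hx)
        exact hn ((mem_swapSet_of_ne hxi hxj).2 hx)
    · rw [mem_coe, mem_shift]
      have hjE : j ∉ E := fun h => hj (hEK h)
      have hsw : swapSet i j E ∈ H :=
        hE _ (swapSet_subset hEK) (by rw [card_swapSet, hEr])
      by_cases hiE : i ∈ E
      · by_cases hEH : E ∈ H
        · exact Or.inl ⟨hEH, fun h => absurd h hjE⟩
        · exact Or.inr ⟨hiE, hjE, hEH, hsw⟩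
      · rw [swapSet_eq_self (by simp [hiE, hjE])] at hsw
        exact Or.inl ⟨hsw, fun h => absurd h hjE⟩

lemma card_shift (i j : ℕ) (H : Finset (Finset ℕ)) : (shift i j H).card = H.card :=
  card_image_of_injOn (shiftMap_injOn i j H)

lemma card_cl_le_shift {r n s i j : ℕ} (hij : i < j) (H : Finset (Finset ℕ)) :
    (cl r n s H).card ≤ (cl r n s (shift i j H : Set (Finset ℕ))).card :=
  (card_shift i j _).symm.trans_le (card_le_card (shift_cl_subset hij))

/-- `H` is stable under all shifts. -/
def Shifted (H : Finset (Finset ℕ)) : Prop :=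
  ∀ i j, i < j → ∀ E ∈ H, j ∈ E → i ∉ E → swapSet i j E ∈ H

lemma sum_swapSet_lt {i j : ℕ} (hij : i < j) {E : Finset ℕ} (hj : j ∈ E) (hi : i ∉ E) :
    ∑ x ∈ swapSet i j E, x < ∑ x ∈ E, x := by
  rw [swapSet_eq_insert hj hi, sum_insert (by simp [hi]), ← add_sum_erase E _ hj]
  simpa using hij

/-- To prove a property of a family it suffices to prove it for shifted families and to carry it
back along shifts. -/
lemma shift_induction {P : Finset (Finset ℕ) → Prop} (h₀ : ∀ H, Shifted H → P H)
    (h₁ : ∀ H i j, i < j → P (shift i j H) → P H) (H : Finset (Finset ℕ)) : P H := by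
  induction hw : ∑ E ∈ H, ∑ x ∈ E, x using Nat.strong_induction_on generalizing H with
  | _ w ih =>
  by_cases hS : Shifted H
  · exact h₀ H hS
  unfold Shifted at hS
  push Not at hS
  obtain ⟨i, j, hij, E, hE, hj, hi, hn⟩ := hS
  refine h₁ H i j hij (ih _ ?_ _ rfl)
  rw [← hw, shift, sum_image (shiftMap_injOn i j H)]
  refine sum_lt_sum (fun F _ => ?_) ⟨E, hE, ?_⟩
  · unfold shiftMap
    split_ifs with h
    · exact (sum_swapSet_lt hij h.1 h.2.1).le
    · exact le_rfl
  · rw [shiftMap, if_pos ⟨hj, hi, hn⟩]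
    exact sum_swapSet_lt hij hj hi

/-- Let y be the least element of E outside E'. Since E' has at least as many elements up to y, it
has some x < y outside E. Exchanging y for x stays in `H`, preserves domination by E', and brings E
closer to E'. -/
lemma Shifted.downClosed {H : Finset (Finset ℕ)} (hH : Shifted H) :
    DownClosed (H : Set (Finset ℕ)) := by
  intro E hE E' hc hcnt
  induction hd : (E \ E').card using Nat.strong_induction_on generalizing E with
  | _ d ih =>
  by_cases hsub : E ⊆ E'
  · rw [← eq_of_subset_of_card_le hsub hc.le]; exact hE
  have hne : (E \ E').Nonempty := by rwa [sdiff_nonempty]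
  set y := (E \ E').min' hne with hy
  have hyE : y ∈ E \ E' := min'_mem _ _
  rw [mem_sdiff] at hyE
  have hmin : ∀ z ∈ E, z < y → z ∈ E' := fun z hz hzy => by
    by_contra h
    exact absurd (min'_le _ z (mem_sdiff.2 ⟨hz, h⟩)) (not_le.2 hzy)
  have hx : ∃ x < y, x ∈ E' ∧ x ∉ E := by
    by_contra hcon
    push Not at hcon
    have h1 := hcnt (y + 1)
    have h2 : cnt E' (y + 1) < cnt E (y + 1) := by
      refine card_lt_card ⟨fun z hz => ?_, fun h => ?_⟩
      · rw [mem_filter] at hz ⊢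
        have hzy : z ≠ y := fun h => hyE.2 (h ▸ hz.1)
        exact ⟨hcon z (by omega) hz.1, hz.2⟩
      · exact hyE.2 (mem_filter.1 (h (mem_filter.2 ⟨hyE.1, Nat.lt_succ_self y⟩))).1
    omega
  obtain ⟨x, hxy, hxE', hxE⟩ := hx
  have hEs := hH x y hxy E hE hyE.1 hxE
  refine ih _ ?_ _ hEs (by rw [card_swapSet, hc]) (fun m => ?_) rfl
  · rw [← hd, swapSet_eq_insert hyE.1 hxE]
    refine card_lt_card ⟨fun z hz => ?_, fun h => ?_⟩
    · simp only [mem_sdiff, mem_insert, mem_erase] at hz ⊢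
      rcases hz with ⟨rfl | hz, hz'⟩
      · exact absurd hxE' hz'
      · exact ⟨hz.2, hz'⟩
    · have := h (mem_sdiff.2 hyE)
      simp only [mem_sdiff, mem_insert, mem_erase, ne_eq, not_true_eq_false, false_and,
        or_false] at this
      omega
  · rw [swapSet_eq_insert hyE.1 hxE]
    by_cases hm : m ≤ y
    · refine card_le_card fun z hz => ?_
      simp only [mem_filter, mem_insert, mem_erase] at hz ⊢
      rcases hz with ⟨rfl | hz, hz'⟩
      · exact ⟨hxE', hz'⟩
      · exact ⟨hmin z hz.2 (by omega), hz'⟩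
    · refine le_trans ?_ (hcnt m)
      have : ((insert x (E.erase y)).filter (· < m)) = insert x ((E.filter (· < m)).erase y) := by
        ext z
        simp only [mem_filter, mem_insert, mem_erase]
        constructor
        · tauto
        · rintro (rfl | h)
          · exact ⟨Or.inl rfl, by omega⟩
          · tauto
      rw [cnt, this, card_insert_of_notMem (by simp [hxE]), card_erase_of_mem (by
        rw [mem_filter]; exact ⟨hyE.1, by omega⟩)]
      have : 0 < (E.filter (· < m)).card := card_pos.2 ⟨y, by
        rw [mem_filter]; exact ⟨hyE.1, by omega⟩⟩
      exact (Nat.sub_add_cancel this).le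

/-! ### Counting in initial segments -/

lemma cnt_mono (E : Finset ℕ) {m m' : ℕ} (h : m ≤ m') : cnt E m ≤ cnt E m' :=
  card_le_card fun x hx => by
    rw [mem_filter] at hx ⊢; exact ⟨hx.1, hx.2.trans_le h⟩

lemma cnt_le_card (E : Finset ℕ) (m : ℕ) : cnt E m ≤ E.card := card_filter_le _ _

lemma cnt_le_add (E : Finset ℕ) (m p : ℕ) : cnt E m ≤ cnt E p + (m - p) := by
  rw [← Nat.card_Ico p m]
  refine le_trans (card_le_card fun x hx => ?_) (card_union_le _ _)
  simp only [mem_filter, mem_union, mem_Ico] at hx ⊢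
  by_cases h : x < p
  · exact Or.inl ⟨hx.1, h⟩
  · exact Or.inr ⟨by omega, hx.2⟩

lemma cnt_le_self (E : Finset ℕ) (m : ℕ) : cnt E m ≤ m := by
  have := cnt_le_add E m 0
  simpa [cnt] using this

lemma cnt_Ico (p q m : ℕ) : cnt (Ico p q) m = min q m - p := by
  rw [cnt, Ico_filter_lt, Nat.card_Ico]

lemma cnt_union {A B : Finset ℕ} (h : Disjoint A B) (m : ℕ) :
    cnt (A ∪ B) m = cnt A m + cnt B m := by
  rw [cnt, filter_union, card_union_of_disjoint (disjoint_filter_filter h)]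

lemma card_le_cnt_add {A : Finset ℕ} {p : ℕ} (h : A ⊆ range p) (m : ℕ) :
    A.card ≤ cnt A m + (p - m) := by
  have h1 := cnt_le_add A p m
  have h2 : cnt A p = A.card := by
    rw [cnt, filter_true_of_mem fun x hx => mem_range.1 (h hx)]
  omega

lemma cnt_le_cnt_of_card {E K : Finset ℕ} (h : E ⊆ K) (m : ℕ) :
    cnt K m + E.card ≤ cnt E m + K.card := by
  have h1 : cnt K m ≤ cnt E m + (K \ E).card := by
    refine le_trans (card_le_card fun x hx => ?_) (card_union_le _ _)
    simp only [mem_filter, mem_union, mem_sdiff] at hx ⊢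
    tauto
  rw [card_sdiff_of_subset h] at h1
  have := card_le_card h
  omega

/-- The largest `r` elements of a set. -/
lemma exists_top {t r : ℕ} {K : Finset ℕ} (hK : K.card = t + r) :
    ∃ T ⊆ K, T.card = r ∧ ∀ m, cnt T m = 0 ∨ cnt T m + t ≤ cnt K m := by
  induction t generalizing K with
  | zero => exact ⟨K, Subset.rfl, by omega, fun m => Or.inr le_rfl⟩
  | succ t ih =>
    have hne : K.Nonempty := card_pos.1 (by omega)
    have hmin := min'_mem K hne
    obtain ⟨T, hT, hc, h⟩ := ih (K := K.erase (K.min' hne))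
      (by rw [card_erase_of_mem hmin]; omega)
    refine ⟨T, hT.trans (erase_subset _ _), hc, fun m => ?_⟩
    by_cases h0 : cnt T m = 0
    · exact Or.inl h0
    right
    have h1 := (h m).resolve_left h0
    obtain ⟨x, hx⟩ := card_pos.1 (Nat.pos_of_ne_zero h0)
    rw [mem_filter] at hx
    have hxm : K.min' hne < m := (min'_le K x (erase_subset _ _ (hT hx.1))).trans_lt hx.2
    have h2 : cnt (K.erase (K.min' hne)) m + 1 = cnt K m := by
      rw [cnt, filter_erase]
      exact card_erase_add_one (mem_filter.2 ⟨hmin, hxm⟩)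
    omega

/-! ### Where cliques of down-closed families are concentrated -/

/-- Every clique of a down-closed family without `k + 1` disjoint members is concentrated on an
initial segment. -/
lemma exists_le_cnt_of_clique {r k t : ℕ} {H : Set (Finset ℕ)} (hD : DownClosed H)
    (hM : MatchFree k H) {K : Finset ℕ} (hc : K.card = t + r)
    (hK : ∀ E ⊆ K, E.card = r → E ∈ H) :
    ∃ i, 1 ≤ i ∧ i ≤ r ∧ t + i ≤ cnt K (i * (k + 1) - 1) := by
  by_contra hcon
  push Not at hcon
  obtain ⟨T, hTK, hTr, hT⟩ := exists_top hc
  have hTH := hK T hTK hTr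
  -- So the i-th smallest element of T, counted from 1, is at least i(k + 1) - 1.
  have hlt : ∀ i, 1 ≤ i → i ≤ r → cnt T (i * (k + 1) - 1) < i := fun i h1 h2 => by
    have := hcon i h1 h2
    rcases hT (i * (k + 1) - 1) with h | h <;> omega
  have hinj : ∀ j, Function.Injective fun l : ℕ => j + l * (k + 1) := fun j x y h => by
    have : x * (k + 1) = y * (k + 1) := by simpa using h
    exact Nat.eq_of_mul_eq_mul_right (Nat.succ_pos k) this
  -- For j ≤ k the i-th element of the progression with first term j and difference k + 1 is at most
  -- k + (i - 1)(k + 1) = i(k + 1) - 1, hence at most the i-th element of T. Distinct j give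
  -- distinct residues.
  refine hM (fun j => (range r).image fun l => j + l * (k + 1)) (fun j hj => ?_)
    (fun i hi j hj hij => ?_)
  · refine hD T hTH _ (by rw [card_image_of_injective _ (hinj j), card_range, hTr]) fun m => ?_
    rcases Nat.eq_zero_or_pos (cnt T m) with h0 | h0
    · rw [h0]; exact Nat.zero_le _
    have hcr : cnt T m ≤ r := hTr ▸ cnt_le_card T m
    have hm : cnt T m * (k + 1) ≤ m := by
      by_contra h
      have := cnt_mono T (show m ≤ cnt T m * (k + 1) - 1 by omega)
      have := hlt _ h0 hcr
      omega
    calc cnt T m = ((range (cnt T m)).image fun l => j + l * (k + 1)).card := by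
          rw [card_image_of_injective _ (hinj j), card_range]
      _ ≤ _ := card_le_card fun x hx => by
          simp only [mem_image, mem_range, mem_filter] at hx ⊢
          obtain ⟨l, hl, rfl⟩ := hx
          refine ⟨⟨l, by omega, rfl⟩, ?_⟩
          have : (l + 1) * (k + 1) ≤ cnt T m * (k + 1) := Nat.mul_le_mul_right _ hl
          have : (l + 1) * (k + 1) = l * (k + 1) + (k + 1) := by ring
          omega
  · rw [Finset.disjoint_left]
    intro x hx hy
    simp only [mem_image, mem_range] at hx hy
    obtain ⟨l, -, rfl⟩ := hx
    obtain ⟨l', -, h⟩ := hy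
    apply hij
    have h1 : (i + l * (k + 1)) % (k + 1) = i := by
      rw [Nat.add_mul_mod_self_right, Nat.mod_eq_of_lt (by omega)]
    have h2 : (j + l' * (k + 1)) % (k + 1) = j := by
      rw [Nat.add_mul_mod_self_right, Nat.mod_eq_of_lt (by omega)]
    rw [← h1, ← h2, h]

lemma exists_blocks (b m : ℕ) {Y : Finset ℕ} (h : b * m ≤ Y.card) :
    ∃ f : ℕ → Finset ℕ, (∀ i < m, f i ⊆ Y ∧ (f i).card = b) ∧
      ∀ i < m, ∀ j < m, i ≠ j → Disjoint (f i) (f j) := by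
  induction m generalizing Y with
  | zero => exact ⟨fun _ => ∅, by simp⟩
  | succ m ih =>
    rw [Nat.mul_succ] at h
    obtain ⟨Z, hZ, hZc⟩ := exists_subset_card_eq (show b ≤ Y.card by omega)
    obtain ⟨f, hf, hd⟩ := ih (Y := Y \ Z) (by rw [card_sdiff_of_subset hZ]; omega)
    have hfZ : ∀ i < m, Disjoint (f i) Z := fun i hi =>
      disjoint_of_subset_left (hf i hi).1 sdiff_disjoint
    refine ⟨fun i => if i = m then Z else f i, fun i hi => ?_, fun i hi j hj hij => ?_⟩
    · by_cases him : i = m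
      · simp [him, hZ, hZc]
      · simp only [him, if_false]
        have := hf i (by omega)
        exact ⟨this.1.trans sdiff_subset, this.2⟩
    · by_cases him : i = m
      · have hjm : j ≠ m := by omega
        simp only [him, hjm, if_true, if_false]
        exact (hfZ j (by omega)).symm
      · by_cases hjm : j = m
        · simp only [him, hjm, if_true, if_false]
          exact hfZ i (by omega)
        · simp only [him, hjm, if_false]
          exact hd i (by omega) j (by omega) hij

/-- If a far set with `a` elements in the core is an edge, then every clique meets the core in the
extremal way. -/
lemma le_cnt_of_far_mem {a r k t : ℕ} {H : Set (Finset ℕ)} (ha : 1 ≤ a) (har : a ≤ r)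
    (ht : t + 1 ≤ a * k) (hD : DownClosed H) (hM : MatchFree k H)
    (hW : Ico (a * k - 1) (a * k + a - 1) ∪ Ico (r * k + a) (r * k + r) ∈ H)
    {K : Finset ℕ} (hc : K.card = t + r) (hK : ∀ E ⊆ K, E.card = r → E ∈ H) :
    t + a ≤ cnt K (a * k + a - 1) := by
  by_contra hcon
  obtain ⟨T, hTK, hTr, hT⟩ := exists_top hc
  have hTH := hK T hTK hTr
  have hDcard : (r - a) * k ≤ (Ico (a * k + r) (r * k + r)).card := by
    rw [Nat.card_Ico, Nat.sub_mul]; omega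
  have hpq : a * k ≤ r * k := Nat.mul_le_mul_right _ har
  -- The core has ak + a - 1 vertices; setting aside a - 1 of them leaves exactly enough for k
  -- blocks of size a.
  have hYcard : a * k ≤ (range (a * k + a - 1) \ Ico t (t + a - 1)).card := by
    have := le_card_sdiff (Ico t (t + a - 1)) (range (a * k + a - 1))
    rw [card_range, Nat.card_Ico] at this
    omega
  obtain ⟨A, hA, hAd⟩ := exists_blocks a k hYcard
  obtain ⟨D, hDD, hDd⟩ := exists_blocks (r - a) k hDcard
  generalize hp : a * k = p at *
  generalize hq : r * k = q at *
  have hTa : cnt T (p + a - 1) < a := by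
    rcases hT (p + a - 1) with h | h <;> omega
  have hdis' : Disjoint (Ico t (t + a - 1)) (Ico (p + a - 1) (p + r)) := by
    rw [Finset.disjoint_left]; intro x; simp only [mem_Ico]; omega
  have hdisW : Disjoint (Ico (p - 1) (p + a - 1)) (Ico (q + a) (q + r)) := by
    rw [Finset.disjoint_left]; intro x; simp only [mem_Ico]; omega
  -- T is pushed down to this set: at least t elements of K precede all of T, and at most a - 1
  -- elements of T lie in the core.
  have hT' : Ico t (t + a - 1) ∪ Ico (p + a - 1) (p + r) ∈ H := by
    refine hD T hTH _ ?_ fun m => ?_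
    · rw [card_union_of_disjoint hdis', Nat.card_Ico, Nat.card_Ico]; omega
    · rw [cnt_union hdis', cnt_Ico, cnt_Ico]
      have h1 := cnt_le_card T m
      have h2 := hT m
      have h3 := cnt_le_self K m
      have h4 := cnt_le_add T m (p + a - 1)
      have h5 : m ≤ p + a - 1 → cnt T m ≤ cnt T (p + a - 1) := fun h => cnt_mono T h
      omega
  have hmem : ∀ i < k, Disjoint (A i) (D i) ∧ A i ∪ D i ∈ H := fun i hi => by
    obtain ⟨hA1, hA2⟩ := hA i hi
    obtain ⟨hD1, hD2⟩ := hDD i hi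
    have hdi : Disjoint (A i) (D i) := by
      rw [Finset.disjoint_left]; intro x hx hx'
      have h1 := hA1 hx
      have h2 := hD1 hx'
      simp only [mem_sdiff, mem_range, mem_Ico] at h1 h2
      omega
    -- W takes the last a core vertices and the last r - a vertices below rk + r, so it lies above
    -- every union of an a-block and an (r - a)-block.
    refine ⟨hdi, hD _ hW _ ?_ fun m => ?_⟩
    · rw [card_union_of_disjoint hdi, card_union_of_disjoint hdisW, Nat.card_Ico, Nat.card_Ico]
      omega
    · rw [cnt_union hdi, cnt_union hdisW, cnt_Ico, cnt_Ico]
      have h1 := card_le_cnt_add (hA1.trans sdiff_subset) m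
      have h2 : (D i).card ≤ cnt (D i) m + (q + r - m) := card_le_cnt_add (fun x hx => by
        have := hD1 hx
        simp only [mem_Ico, mem_range] at this ⊢
        exact this.2) m
      omega
  have hcross : ∀ i < k, Disjoint (A i ∪ D i) (Ico t (t + a - 1) ∪ Ico (p + a - 1) (p + r)) :=
    fun i hi => by
    rw [Finset.disjoint_left]; intro x hx
    rw [mem_union] at hx
    rcases hx with hx | hx
    · have h1 := (hA i hi).1 hx
      simp only [mem_sdiff, mem_range, mem_Ico, mem_union] at h1 ⊢
      omega
    · have h1 := (hDD i hi).1 hx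
      simp only [mem_Ico, mem_union] at h1 ⊢
      omega
  refine hM (fun i => if i < k then A i ∪ D i else Ico t (t + a - 1) ∪ Ico (p + a - 1) (p + r))
    (fun i hi => ?_) (fun i hi j hj hij => ?_)
  · by_cases h : i < k
    · simp only [h, if_true]; exact (hmem i h).2
    · simp only [h, if_false]; exact hT'
  · by_cases h : i < k
    · by_cases h' : j < k
      · simp only [h, h', if_true]
        rw [Finset.disjoint_left]; intro x hx hx'
        rw [mem_union] at hx hx'
        rcases hx with hx | hx <;> rcases hx' with hx' | hx'
        · exact Finset.disjoint_left.1 (hAd i h j h' hij) hx hx'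
        · have h1 := (hA i h).1 hx
          have h2 := (hDD j h').1 hx'
          simp only [mem_sdiff, mem_range, mem_Ico] at h1 h2
          omega
        · have h1 := (hA j h').1 hx'
          have h2 := (hDD i h).1 hx
          simp only [mem_sdiff, mem_range, mem_Ico] at h1 h2
          omega
        · exact Finset.disjoint_left.1 (hDd i h j h' hij) hx hx'
      · simp only [h, h', if_true, if_false]; exact hcross i h
    · have h' : j < k := by omega
      simp only [h, h', if_true, if_false]; exact (hcross j h').symm

/-! ### Large cliques and stability -/

lemma cl_subset_of_large {r k t n : ℕ} {H : Set (Finset ℕ)} (hD : DownClosed H)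
    (hM : MatchFree k H) (ht : (r - 1) * k ≤ t) :
    cl r n (t + r) H ⊆ (range (r * k + r - 1)).powersetCard (t + r) := by
  intro K hK
  obtain ⟨-, hc, hE⟩ := mem_cl.1 hK
  obtain ⟨i, hi1, hir, hi⟩ := exists_le_cnt_of_clique hD hM hc hE
  have h1 := cnt_le_self K (i * (k + 1) - 1)
  -- From t + i ≤ i(k + 1) - 1 it follows that ik > t ≥ (r - 1)k.
  have hri : r = i := by
    by_contra hne
    have : i * k ≤ (r - 1) * k := Nat.mul_le_mul_right _ (by omega)
    have : i * (k + 1) = i * k + i := by ring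
    omega
  subst hri
  rw [mem_powersetCard]
  refine ⟨?_, hc⟩
  have hfull : K.filter (· < r * (k + 1) - 1) = K :=
    eq_of_subset_of_card_le (filter_subset _ _) (by rw [hc]; exact hi)
  intro x hx
  rw [← hfull, mem_filter] at hx
  rw [mem_range]
  exact hx.2

lemma card_cl_le_of_large {r k t n : ℕ} (ht : (r - 1) * k ≤ t) (H : Finset (Finset ℕ)) :
    MatchFree k (H : Set (Finset ℕ)) →
      (cl r n (t + r) H).card ≤ (r * k + r - 1).choose (t + r) := by
  induction H using shift_induction with
  | h₀ H hS =>
    intro hM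
    have := card_le_card (cl_subset_of_large (n := n) hS.downClosed hM ht)
    rwa [card_powersetCard, card_range] at this
  | h₁ H i j hij ih =>
    intro hM
    exact (card_cl_le_shift hij H).trans (ih (matchFree_shift hM))

/-- Two differently coloured `b`-subsets of `Y` can be chosen almost equal. -/
lemma exists_adjacent_of_colouring {Y : Finset ℕ} {b : ℕ} (P : Finset ℕ → Prop) {A B : Finset ℕ}
    (hA : A ⊆ Y) (hAb : A.card = b) (hPA : P A) (hB : B ⊆ Y) (hBb : B.card = b) (hPB : ¬ P B) :
    ∃ A' B' : Finset ℕ, A' ⊆ Y ∧ A'.card = b ∧ P A' ∧ B' ⊆ Y ∧ B'.card = b ∧ ¬ P B' ∧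
      (A' ∪ B').card ≤ b + 1 := by
  induction hd : (A \ B).card using Nat.strong_induction_on generalizing A with
  | _ d ih =>
  have hne : A ≠ B := fun h => hPB (h ▸ hPA)
  obtain ⟨x, hx⟩ : (A \ B).Nonempty := by
    rw [sdiff_nonempty]
    exact fun h => hne (eq_of_subset_of_card_le h (by omega))
  obtain ⟨y, hy⟩ : (B \ A).Nonempty := by
    rw [sdiff_nonempty]
    exact fun h => hne (eq_of_subset_of_card_le h (by omega)).symm
  rw [mem_sdiff] at hx hy
  have hA₁ : insert y (A.erase x) ⊆ Y := insert_subset (hB hy.1) ((erase_subset _ _).trans hA)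
  have hpos : 0 < A.card := card_pos.2 ⟨x, hx.1⟩
  have hc₁ : (insert y (A.erase x)).card = b := by
    rw [card_insert_of_notMem (by simp [hy.2]), card_erase_of_mem hx.1]; omega
  by_cases hP₁ : P (insert y (A.erase x))
  · refine ih _ ?_ hA₁ hc₁ hP₁ rfl
    rw [← hd]
    refine card_lt_card ⟨fun z hz => ?_, fun h => ?_⟩
    · simp only [mem_sdiff, mem_insert, mem_erase] at hz ⊢
      rcases hz with ⟨rfl | hz, hz'⟩
      · exact absurd hy.1 hz'
      · exact ⟨hz.2, hz'⟩
    · have := h (mem_sdiff.2 hx)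
      simp only [mem_sdiff, mem_insert, mem_erase, ne_eq, not_true_eq_false, false_and,
        or_false] at this
      exact hy.2 (this.1 ▸ hx.1)
  · refine ⟨A, _, hA, hAb, hPA, hA₁, hc₁, hP₁, ?_⟩
    have : A ∪ insert y (A.erase x) ⊆ insert y A := by
      intro z; simp only [mem_union, mem_insert, mem_erase]; tauto
    exact (card_le_card this).trans ((card_insert_le _ _).trans (by omega))

lemma mem_of_mem_shift_of_notMem {i j : ℕ} {H : Finset (Finset ℕ)} {E : Finset ℕ}
    (h : E ∈ shift i j H) (hi : i ∉ E) : E ∈ H := by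
  rcases mem_shift.1 h with h | h
  · exact h.1
  · exact absurd h.1 hi

lemma insert_mem_or_of_mem_shift {i j : ℕ} {H : Finset (Finset ℕ)} {A : Finset ℕ} (hij : i ≠ j)
    (h : insert i A ∈ shift i j H) (hi : i ∉ A) (hj : j ∉ A) : insert i A ∈ H ∨ insert j A ∈ H := by
  rcases mem_shift.1 h with h | h
  · exact Or.inl h.1
  · right
    have h' := h.2.2.2
    have : swapSet i j (insert i A) = swapSet j i (insert i A) := by
      unfold swapSet; rw [Equiv.swap_comm]
    rwa [this, swapSet_eq_insert (mem_insert_self _ _) (by simp [hj, hij.symm]),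
      erase_insert hi] at h'

/-- A family whose shift contains a complete `r`-graph on `rk + r - 1` vertices contains one
itself. -/
lemma exists_complete_of_shift {r k i j : ℕ} (hr : 1 ≤ r) (hk : 2 ≤ k) (hij : i < j)
    {H : Finset (Finset ℕ)} (hM : MatchFree k (H : Set (Finset ℕ))) {X : Finset ℕ}
    (hXc : X.card = r * k + r - 1) (hX : ∀ E ⊆ X, E.card = r → E ∈ shift i j H) :
    ∃ X : Finset ℕ, X.card = r * k + r - 1 ∧ ∀ E ⊆ X, E.card = r → E ∈ H := by
  have hrk : r * 2 ≤ r * k := Nat.mul_le_mul_left _ hk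
  by_cases hiX : i ∉ X
  · exact ⟨X, hXc, fun E hE hEr =>
      mem_of_mem_shift_of_notMem (hX E hE hEr) fun h => hiX (hE h)⟩
  push Not at hiX
  by_cases hjX : j ∈ X
  · refine ⟨X, hXc, fun E hE hEr => ?_⟩
    by_cases hiE : i ∉ E
    · exact mem_of_mem_shift_of_notMem (hX E hE hEr) hiE
    push Not at hiE
    rcases mem_shift.1 (hX E hE hEr) with h | h
    · exact h.1
    · exfalso
      obtain ⟨h1, h2, h3, h4⟩ := h
      have hsub : swapSet i j E ⊆ X := by
        intro x hx
        by_cases hxi : x = i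
        · rwa [hxi]
        by_cases hxj : x = j
        · rwa [hxj]
        exact hE ((mem_swapSet_of_ne hxi hxj).1 hx)
      rcases mem_shift.1 (hX _ hsub (by rw [card_swapSet, hEr])) with h | h
      · have := h.2 (right_mem_swapSet.2 h1) (fun h => h2 (left_mem_swapSet.1 h))
        rw [swapSet_swapSet] at this
        exact h3 this
      · exact h2 (left_mem_swapSet.1 h.1)
  set Y := X.erase i with hY
  have hYc : Y.card = r * k + r - 2 := by rw [hY, card_erase_of_mem hiX, hXc]; omega
  have hiY : i ∉ Y := by simp [hY]
  have hjY : j ∉ Y := fun h => hjX (mem_of_mem_erase h)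
  have hYX : Y ⊆ X := erase_subset _ _
  have hYH : ∀ E ⊆ Y, E.card = r → E ∈ H := fun E hE hEr =>
    mem_of_mem_shift_of_notMem (hX E (hE.trans hYX) hEr) fun h => hiY (hE h)
  -- Colour the (r - 1)-subsets of Y by whether i completes them to an edge; where i fails, j works.
  -- If neither i nor j works throughout, two adjacent subsets of different colours lead to a
  -- matching of k + 1 edges.
  have hor : ∀ A ⊆ Y, A.card = r - 1 → insert i A ∈ H ∨ insert j A ∈ H := fun A hA hAc => by
    have hiA : i ∉ A := fun h => hiY (hA h)
    refine insert_mem_or_of_mem_shift hij.ne (hX _ (insert_subset hiX (hA.trans hYX)) ?_) hiA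
      fun h => hjY (hA h)
    rw [card_insert_of_notMem hiA]; omega
  have hone : ∀ x, x ∉ Y → (∀ A ⊆ Y, A.card = r - 1 → insert x A ∈ H) →
      ∃ X : Finset ℕ, X.card = r * k + r - 1 ∧ ∀ E ⊆ X, E.card = r → E ∈ H := by
    intro x hx hA
    refine ⟨insert x Y, by rw [card_insert_of_notMem hx]; omega, fun E hE hEr => ?_⟩
    by_cases hxE : x ∈ E
    · rw [← insert_erase hxE]
      refine hA _ ?_ (by rw [card_erase_of_mem hxE, hEr])
      rwa [← subset_insert_iff]
    · exact hYH E ((subset_insert_iff_of_notMem hxE).1 hE) hEr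
  by_cases hi : ∀ A ⊆ Y, A.card = r - 1 → insert i A ∈ H
  · exact hone i hiY hi
  by_cases hj : ∀ A ⊆ Y, A.card = r - 1 → insert j A ∈ H
  · exact hone j hjY hj
  exfalso
  push Not at hi hj
  obtain ⟨B, hB, hBc, hBi⟩ := hi
  obtain ⟨A, hA, hAc, hAj⟩ := hj
  obtain ⟨A', B', hA', hAc', hAi', hB', hBc', hBi', hAB⟩ :=
    exists_adjacent_of_colouring (fun A => insert i A ∈ H) hA hAc ((hor A hA hAc).resolve_right hAj)
      hB hBc hBi
  obtain ⟨P, Q, hP, hPc, hQ, hQc, hPQ, hPi, hQj⟩ : ∃ P Q : Finset ℕ, P ⊆ Y ∧ P.card = r - 1 ∧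
      Q ⊆ Y ∧ Q.card = r - 1 ∧ Disjoint P Q ∧ insert i P ∈ H ∧ insert j Q ∈ H := by
    -- The union of A' and B' has at most r elements, so an (r - 1)-set C disjoint from both fits in
    -- Y because k ≥ 2. Whatever the colour of C, one of A', B' has the opposite role.
    obtain ⟨C, hC, hCc⟩ := exists_subset_card_eq (s := Y \ (A' ∪ B')) (n := r - 1) (by
      rw [card_sdiff_of_subset (union_subset hA' hB')]; omega)
    have hCd : Disjoint C (A' ∪ B') := disjoint_of_subset_left hC sdiff_disjoint
    rw [disjoint_union_right] at hCd
    have hCY : C ⊆ Y := hC.trans sdiff_subset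
    by_cases hCi : insert i C ∈ H
    · exact ⟨C, B', hCY, hCc, hB', hBc', hCd.2, hCi, (hor B' hB' hBc').resolve_left hBi'⟩
    · exact ⟨A', C, hA', hAc', hCY, hCc, hCd.1.symm, hAi', (hor C hCY hCc).resolve_left hCi⟩
  -- Y without P and Q has (rk + r - 2) - 2(r - 1) = r(k - 1) vertices, which supply the remaining k
  -- - 1 disjoint edges.
  obtain ⟨f, hf, hfd⟩ := exists_blocks r (k - 1) (Y := Y \ (P ∪ Q)) (by
    rw [card_sdiff_of_subset (union_subset hP hQ), card_union_of_disjoint hPQ, Nat.mul_sub]; omega)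
  have hfP : ∀ l < k - 1, Disjoint (f l) (insert i P) := fun l hl => by
    rw [Finset.disjoint_left]; intro x hx
    have := (hf l hl).1 hx
    simp only [mem_sdiff, mem_union, mem_insert] at this ⊢
    rintro (rfl | h)
    · exact hiY this.1
    · tauto
  have hfQ : ∀ l < k - 1, Disjoint (f l) (insert j Q) := fun l hl => by
    rw [Finset.disjoint_left]; intro x hx
    have := (hf l hl).1 hx
    simp only [mem_sdiff, mem_union, mem_insert] at this ⊢
    rintro (rfl | h)
    · exact hjY this.1
    · tauto
  have hPQ' : Disjoint (insert i P) (insert j Q) := by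
    rw [disjoint_insert_left, disjoint_insert_right, mem_insert]
    exact ⟨fun h => h.elim hij.ne fun h => hiY (hQ h), fun h => hjY (hP h), hPQ⟩
  let g : ℕ → Finset ℕ := fun l =>
    if l < k - 1 then f l else if l = k - 1 then insert i P else insert j Q
  have hg : ∀ l m, l ≤ k → m ≤ k → l < m → Disjoint (g l) (g m) := by
    intro l m hl hm hlm
    by_cases h1 : l < k - 1
    · by_cases h2 : m < k - 1
      · simp only [g, h1, h2, if_true]; exact hfd l h1 m h2 hlm.ne
      by_cases h3 : m = k - 1
      · simp only [g, h1, if_true, h3]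
        simpa using hfP l h1
      · simp only [g, h1, h2, if_true, if_false, h3]; exact hfQ l h1
    · have h2 : ¬ m < k - 1 := by omega
      have h3 : m ≠ k - 1 := by omega
      have h4 : l = k - 1 := by omega
      simp only [g, h2, if_true, if_false, h3, h4]
      simpa using hPQ'
  refine hM g (fun l _ => ?_) (fun l hl m hm hlm => ?_)
  · simp only [g]
    split_ifs with h1 h2
    · exact hYH _ ((hf l h1).1.trans sdiff_subset) (hf l h1).2
    · exact hPi
    · exact hQj
  · rcases lt_or_gt_of_ne hlm with h | h
    · exact hg l m hl hm h
    · exact (hg m l hm hl h).symm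

/-- Completeness is an alternative in the statement because only the disjunction survives being
carried back along shifts: the clique bound pulls back by monotonicity, completeness by
`exists_complete_of_shift`. -/
lemma complete_or_card_cl_add_le {r k t n : ℕ} (hr : 1 ≤ r) (hk : 2 ≤ k) (ht : (r - 1) * k ≤ t)
    (H : Finset (Finset ℕ)) :
    MatchFree k (H : Set (Finset ℕ)) →
      (∃ X : Finset ℕ, X.card = r * k + r - 1 ∧ ∀ E ⊆ X, E.card = r → E ∈ H) ∨
      (cl r n (t + r) H).card + (r * k - 1).choose t ≤ (r * k + r - 1).choose (t + r) := by
  induction H using shift_induction with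
  | h₀ H hS =>
    intro hM
    have hrk : r * 2 ≤ r * k := Nat.mul_le_mul_left _ hk
    -- This is the highest r-subset of the first rk + r - 1 vertices: if it is an edge, so are all
    -- the others. If not, every s-set of these vertices that contains it is lost, which the family
    -- G counts.
    by_cases hE₀ : Ico (r * k - 1) (r * k + r - 1) ∈ H
    · refine Or.inl ⟨range (r * k + r - 1), card_range _, fun E hE hEr => ?_⟩
      refine hS.downClosed _ hE₀ E (by rw [hEr, Nat.card_Ico]; omega) fun m => ?_
      rw [cnt_Ico]
      have := card_le_cnt_add hE m
      omega
    · right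
      have hdis : Disjoint (range (r * k - 1)) (Ico (r * k - 1) (r * k + r - 1)) := by
        rw [Finset.disjoint_left]; intro x; simp only [mem_range, mem_Ico]; omega
      have hZd : ∀ Z ∈ (range (r * k - 1)).powersetCard t,
          Disjoint Z (Ico (r * k - 1) (r * k + r - 1)) := fun Z hZ =>
        disjoint_of_subset_left (mem_powersetCard.1 hZ).1 hdis
      set G := ((range (r * k - 1)).powersetCard t).image
        fun Z => Z ∪ Ico (r * k - 1) (r * k + r - 1) with hG
      have hGc : G.card = (r * k - 1).choose t := by
        rw [hG, card_image_of_injOn, card_powersetCard, card_range]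
        intro Z hZ Z' hZ' h
        have h1 := union_sdiff_cancel_right (hZd Z hZ)
        have h2 := union_sdiff_cancel_right (hZd Z' hZ')
        simp only at h
        rw [← h1, ← h2, h]
      have hGs : G ⊆ (range (r * k + r - 1)).powersetCard (t + r) := by
        intro K hK
        obtain ⟨Z, hZ, rfl⟩ := mem_image.1 hK
        rw [mem_powersetCard, card_union_of_disjoint (hZd Z hZ), (mem_powersetCard.1 hZ).2,
          Nat.card_Ico]
        refine ⟨union_subset ((mem_powersetCard.1 hZ).1.trans fun x => ?_) fun x => ?_, by omega⟩
        · simp only [mem_range]; omega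
        · simp only [mem_range, mem_Ico]; omega
      have hdisG : Disjoint (cl r n (t + r) H) G := by
        rw [Finset.disjoint_left]; intro K hK hKG
        obtain ⟨Z, hZ, rfl⟩ := mem_image.1 hKG
        exact hE₀ ((mem_cl.1 hK).2.2 _ subset_union_right (by rw [Nat.card_Ico]; omega))
      rw [← hGc, ← card_union_of_disjoint hdisG, ← card_range (r * k + r - 1), ← card_powersetCard]
      exact card_le_card (union_subset (cl_subset_of_large hS.downClosed hM ht) hGs)
  | h₁ H i j hij ih =>
    intro hM
    rcases ih (matchFree_shift hM) with ⟨X, hXc, hX⟩ | h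
    · exact Or.inl (exists_complete_of_shift hr hk hij hM hXc hX)
    · exact Or.inr ((Nat.add_le_add_right (card_cl_le_shift hij H) _).trans h)

/-- The stability part for large cliques. -/
lemma card_cl_add_le_of_lt {r k t n : ℕ} (hr : 1 ≤ r) (ht : (r - 1) * k ≤ t) (htk : t + 1 ≤ r * k)
    (H : Finset (Finset ℕ)) (hHn : ∀ E ∈ H, E ⊆ range n)
    (hM : MatchFree k (H : Set (Finset ℕ)))
    (hlt : (cl r n (t + r) H).card < (r * k + r - 1).choose (t + r)) :
    (cl r n (t + r) H).card + (r * k - 1).choose t ≤ (r * k + r - 1).choose (t + r) := by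
  rcases (show k = 0 ∨ k = 1 ∨ 2 ≤ k by omega) with rfl | rfl | hk
  · omega
  -- For k = 1 both binomials equal 1, so strict inequality means that there is no clique, and this
  -- is already the bound.
  · have : t = r - 1 := by omega
    subst this
    rw [show r * 1 + r - 1 = r - 1 + r by omega, Nat.choose_self] at *
    rw [show r * 1 - 1 = r - 1 by omega, Nat.choose_self]
    omega
  · refine (complete_or_card_cl_add_le hr hk ht H hM).resolve_left ?_
    rintro ⟨X, hXc, hX⟩
    refine absurd hlt (not_lt.2 ?_)
    have hrk : r * 2 ≤ r * k := Nat.mul_le_mul_left _ hk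
    rw [← hXc, ← card_powersetCard]
    refine card_le_card fun K hK => ?_
    rw [mem_powersetCard] at hK
    refine mem_cl.2 ⟨fun x hx => ?_, hK.2, fun E hE => hX E (hE.trans hK.1)⟩
    -- Each vertex of X lies in some r-subset of X; this is an edge, so the vertex is below n.
    obtain ⟨E, h1, h2, h3⟩ := exists_subsuperset_card_eq
      (singleton_subset_iff.2 (hK.1 hx)) (by simpa using hr) (show r ≤ X.card by omega)
    exact hHn E (hX E h2 h3) (h1 (mem_singleton_self x))

/-! ### Numerical estimates -/

lemma choose_le_exp_mul_div_pow (N : ℕ) {m : ℕ} (hm : 1 ≤ m) :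
    (N.choose m : ℝ) ≤ (Real.exp 1 * N / m) ^ m := by
  have h1 := Nat.choose_le_pow_div (α := ℝ) m N
  have h2 := Real.pow_div_factorial_le_exp (x := (m : ℝ)) (by positivity) m
  have hm0 : (0 : ℝ) < m := by exact_mod_cast hm
  have hf : (0 : ℝ) < m.factorial := by exact_mod_cast m.factorial_pos
  have h3 : Real.exp m = Real.exp 1 ^ m := by rw [← Real.exp_nat_mul, mul_one]
  rw [h3, div_le_iff₀ hf] at h2
  refine h1.trans ?_
  rw [div_pow, mul_pow, div_le_div_iff₀ hf (by positivity)]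
  calc (N : ℝ) ^ m * (m : ℝ) ^ m ≤ (N : ℝ) ^ m * (Real.exp 1 ^ m * m.factorial) := by gcongr
    _ = _ := by ring

/-- Induction through C(k + 1, u + 1) = C(k, u)(k + 1)/(u + 1), since (k + 1)/(u + 1) ≤ k/u for 0 <
u ≤ k. -/
lemma div_pow_le_choose {k u : ℕ} (h : u ≤ k) : ((k : ℝ) / u) ^ u ≤ k.choose u := by
  induction u generalizing k with
  | zero => simp
  | succ u ih =>
    obtain ⟨k, rfl⟩ : ∃ k', k = k' + 1 := ⟨k - 1, by omega⟩
    have h1 := ih (show u ≤ k by omega)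
    have h2 : ((k : ℝ) + 1) * k.choose u = (k + 1).choose (u + 1) * (u + 1) := by
      exact_mod_cast Nat.add_one_mul_choose_eq k u
    have h3 : (((k : ℝ) + 1) / (u + 1)) ^ u ≤ ((k : ℝ) / u) ^ u := by
      rcases Nat.eq_zero_or_pos u with rfl | hu
      · simp
      · have hu' : (0 : ℝ) < u := by exact_mod_cast hu
        have huk : (u : ℝ) ≤ k := by exact_mod_cast (show u ≤ k by omega)
        gcongr ?_ ^ _
        rw [div_le_div_iff₀ (by positivity) hu']
        nlinarith
    push_cast
    calc (((k : ℝ) + 1) / (u + 1)) ^ (u + 1)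
        = (((k : ℝ) + 1) / (u + 1)) ^ u * (((k : ℝ) + 1) / (u + 1)) := pow_succ _ _
      _ ≤ k.choose u * (((k : ℝ) + 1) / (u + 1)) := by
          gcongr; exact h3.trans h1
      _ = (k + 1).choose (u + 1) := by
          field_simp; linarith

lemma choose_sub_mul_pow_le {n c q l r : ℕ} (hn : 0 < n) (hlq : l ≤ q) (hqr : q ≤ r)
    (h : 16 * (q * (c + q)) ≤ n) :
    (15 / 16 : ℝ) * n.choose (q - l) * (n : ℝ) ^ l ≤ (r : ℝ) ^ l * (n - c).choose q := by
  have hn0 : (0 : ℝ) < n := by exact_mod_cast hn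
  rcases Nat.eq_zero_or_pos q with rfl | hq
  · obtain rfl : l = 0 := by omega
    norm_num
  have hcq : c + q ≤ n := by nlinarith
  have h1 : (n.choose (q - l) : ℝ) * (q - l).factorial ≤ (n : ℝ) ^ (q - l) := by
    have := Nat.choose_le_pow_div (α := ℝ) (q - l) n
    rwa [le_div_iff₀ (by exact_mod_cast (q - l).factorial_pos)] at this
  have h2 : ((n : ℝ) - (c + q)) ^ q ≤ q.factorial * (n - c).choose q := by
    have h3 := Nat.pow_sub_le_descFactorial (n - c) q
    rw [Nat.descFactorial_eq_factorial_mul_choose] at h3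
    have h4 : (n - (c + q)) ^ q ≤ q.factorial * (n - c).choose q :=
      (Nat.pow_le_pow_left (by omega) q).trans h3
    have h5 : (((n - (c + q) : ℕ) : ℝ)) ^ q ≤ q.factorial * (n - c).choose q := by exact_mod_cast h4
    rwa [Nat.cast_sub hcq, Nat.cast_add] at h5
  -- Bernoulli: (1 - (c + q)/n)^q ≥ 1 - q(c + q)/n ≥ 15/16.
  have h3 : (n : ℝ) ^ q * (15 / 16) ≤ ((n : ℝ) - (c + q)) ^ q := by
    have hx : (q : ℝ) * (((c : ℝ) + q) / n) ≤ 1 / 16 := by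
      rw [← mul_div_assoc, div_le_iff₀ hn0]
      have : (16 : ℝ) * (q * (c + q)) ≤ n := by exact_mod_cast h
      linarith
    have hx1 : ((c : ℝ) + q) / n ≤ 1 := by
      rw [div_le_one hn0]; exact_mod_cast hcq
    have hb := one_add_mul_le_pow (a := -(((c : ℝ) + q) / n)) (by linarith) q
    have he : (n : ℝ) - (c + q) = n * (1 + -(((c : ℝ) + q) / n)) := by field_simp; ring
    rw [he, mul_pow]
    gcongr
    refine le_trans ?_ hb
    linarith
  have h4 : (q.factorial : ℝ) ≤ (q - l).factorial * (r : ℝ) ^ l := by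
    have h5 : (q - l).factorial * q.descFactorial l = q.factorial :=
      Nat.factorial_mul_descFactorial hlq
    have h6 : q.descFactorial l ≤ r ^ l :=
      (Nat.descFactorial_le_pow q l).trans (Nat.pow_le_pow_left hqr l)
    have h7 : q.factorial ≤ (q - l).factorial * r ^ l := h5 ▸ Nat.mul_le_mul_left _ h6
    exact_mod_cast h7
  have hf : (0 : ℝ) < (q - l).factorial := by exact_mod_cast (q - l).factorial_pos
  refine le_of_mul_le_mul_left ?_ hf
  calc ((q - l).factorial : ℝ) * (15 / 16 * n.choose (q - l) * (n : ℝ) ^ l)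
      = 15 / 16 * (n : ℝ) ^ l * (n.choose (q - l) * (q - l).factorial) := by ring
    _ ≤ 15 / 16 * (n : ℝ) ^ l * (n : ℝ) ^ (q - l) := by gcongr
    _ = (n : ℝ) ^ q * (15 / 16) := by
        rw [mul_assoc, ← pow_add, Nat.add_sub_cancel' hlq, mul_comm]
    _ ≤ q.factorial * (n - c).choose q := h3.trans h2
    _ ≤ (q - l).factorial * (r : ℝ) ^ l * (n - c).choose q := by gcongr
    _ = _ := by ring

/-- The ratio form of `choose_sub_mul_pow_le`. -/
lemma choose_sub_le {n c q l r : ℕ} (hn : 0 < n) (hlq : l ≤ q) (hqr : q ≤ r)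
    (h : 16 * (q * (c + q)) ≤ n) :
    (n.choose (q - l) : ℝ) ≤ 16 / 15 * ((r : ℝ) / n) ^ l * (n - c).choose q := by
  have h1 := choose_sub_mul_pow_le hn hlq hqr h
  have hn0 : (0 : ℝ) < n := by exact_mod_cast hn
  have hp : (0 : ℝ) < (n : ℝ) ^ l := by positivity
  rw [div_pow]
  have : (16 / 15 * ((r : ℝ) ^ l / (n : ℝ) ^ l) * (n - c).choose q : ℝ)
      = (16 / 15 * ((r : ℝ) ^ l * (n - c).choose q)) / (n : ℝ) ^ l := by ring
  rw [this, le_div_iff₀ hp]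
  linarith

/-- The factor 3/4 normalises the series of ratio 1/4: its total is 1. -/
lemma sum_le_of_geometric {b r : ℕ} {f : ℕ → ℝ} {M : ℝ} (hM : 0 ≤ M)
    (hf : ∀ i ∈ Icc b r, f i ≤ 3 / 4 * (1 / 4) ^ (i - b) * M) : ∑ i ∈ Icc b r, f i ≤ M := by
  have hg : ∀ m : ℕ, ∑ j ∈ range m, (3 / 4 * (1 / 4 : ℝ) ^ j) = 1 - (1 / 4) ^ m := by
    intro m
    induction m with
    | zero => simp
    | succ m ih => rw [sum_range_succ, ih]; ring
  have hIcc : Icc b r = Ico b (r + 1) := by ext x; simp only [mem_Icc, mem_Ico]; omega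
  calc ∑ i ∈ Icc b r, f i ≤ ∑ i ∈ Icc b r, 3 / 4 * (1 / 4) ^ (i - b) * M := sum_le_sum hf
    _ = ∑ j ∈ range (r + 1 - b), 3 / 4 * (1 / 4 : ℝ) ^ j * M := by
        rw [hIcc, sum_Ico_eq_sum_range]; simp
    _ = (1 - (1 / 4) ^ (r + 1 - b)) * M := by rw [← sum_mul, hg]
    _ ≤ 1 * M := by
        gcongr
        have : (0 : ℝ) ≤ (1 / 4) ^ (r + 1 - b) := by positivity
        linarith
    _ = M := one_mul M

lemma exp_one_bounds : (2.7 : ℝ) < Real.exp 1 ∧ Real.exp 1 < 2.72 :=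
  ⟨by linarith [Real.exp_one_gt_d9], by linarith [Real.exp_one_lt_d9]⟩

/-- The ratio estimate behind the case of one core vertex. -/
lemma exp_mul_pow_mul_le {r t l : ℕ} (hlr : l + 2 ≤ r) :
    (Real.exp 1 * (l + 2 : ℝ)) ^ (t + 2 + l) *
      ((r : ℝ) / (4 * (Real.exp 1 * r) ^ (t + 2))) ^ (l + 1) ≤ 1 / 2 * (1 / 4) ^ l := by
  obtain ⟨he1, he2⟩ := exp_one_bounds
  set e := Real.exp 1
  have hr2 : (l : ℝ) + 2 ≤ r := by exact_mod_cast hlr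
  have hl0 : (0 : ℝ) ≤ l := by positivity
  have hr0 : (2 : ℝ) ≤ r := by linarith
  have hrp : (0 : ℝ) < r := by linarith
  have hx : (0 : ℝ) < (e * r) ^ (t + 2) := by positivity
  have hx2 : (e * r) ^ 2 ≤ (e * r) ^ (t + 2) := pow_le_pow_right₀ (by nlinarith) (by omega)
  have h1 : (e * (l + 2 : ℝ)) ^ (t + 2) * (r / (4 * (e * r) ^ (t + 2))) ≤ (l + 2) ^ 2 / (4 * r) := by
    have h3 : (e * (l + 2 : ℝ)) ^ (t + 2) = ((l + 2 : ℝ) / r) ^ (t + 2) * (e * r) ^ (t + 2) := by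
      rw [← mul_pow]; congr 1; field_simp
    have h4 : ((l + 2 : ℝ) / r) ^ (t + 2) ≤ ((l + 2 : ℝ) / r) ^ 2 :=
      pow_le_pow_of_le_one (by positivity) ((div_le_one hrp).2 hr2) (by omega)
    calc _ = ((l + 2 : ℝ) / r) ^ (t + 2) * (r / 4) := by rw [h3]; field_simp
      _ ≤ ((l + 2 : ℝ) / r) ^ 2 * (r / 4) := by gcongr
      _ = _ := by field_simp
  have h2 : e * (l + 2 : ℝ) * (r / (4 * (e * r) ^ (t + 2))) ≤ 1 / (4 * e) := by
    calc e * (l + 2 : ℝ) * (r / (4 * (e * r) ^ (t + 2))) ≤ e * r * (r / (4 * (e * r) ^ 2)) := by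
          gcongr
      _ = 1 / (4 * e) := by field_simp
  have h5 : ((l : ℝ) + 2) ^ 2 / (4 * r) ≤ 1 / 2 * (9 / 4) ^ l := by
    have hb := one_add_mul_le_pow (a := (1 / 2 : ℝ)) (by norm_num) l
    have h6 : ((l : ℝ) + 2) ^ 2 ≤ 4 * (9 / 4) ^ l := by
      have h7 : (l : ℝ) + 2 ≤ 2 * (3 / 2) ^ l := by
        norm_num at hb ⊢; linarith
      calc ((l : ℝ) + 2) ^ 2 ≤ (2 * (3 / 2) ^ l) ^ 2 := by gcongr
        _ = 4 * (((3 / 2) ^ 2) ^ l) := by rw [mul_pow, ← pow_mul, ← pow_mul, mul_comm l]; norm_num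
        _ = _ := by norm_num
    rw [div_le_iff₀ (by positivity)]
    have : (0 : ℝ) < (9 / 4) ^ l := by positivity
    nlinarith
  -- One factor z absorbs y^(t + 2); each of the other l factors z is paired with one y. The growth
  -- (9/4)^l of the first part is paid for by the second, since 9/4 ≤ e.
  have hkey : ∀ y z : ℝ, y ^ (t + 2 + l) * z ^ (l + 1) = y ^ (t + 2) * z * (y * z) ^ l := by
    intro y z
    rw [pow_add y (t + 2) l, pow_succ z l, mul_pow]; ring
  calc _ = ((e * (l + 2 : ℝ)) ^ (t + 2) * (r / (4 * (e * r) ^ (t + 2)))) *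
        (e * (l + 2 : ℝ) * (r / (4 * (e * r) ^ (t + 2)))) ^ l := by
        exact hkey _ _
    _ ≤ (1 / 2 * (9 / 4) ^ l) * (1 / (4 * e)) ^ l :=
        mul_le_mul (h1.trans h5) (pow_le_pow_left₀ (by positivity) h2 l) (by positivity)
          (by positivity)
    _ = 1 / 2 * (9 / 4 * (1 / (4 * e))) ^ l := by rw [mul_pow]; ring
    _ ≤ 1 / 2 * (1 / 4) ^ l := by
        gcongr
        rw [mul_one_div, div_le_iff₀ (by positivity)]
        linarith

/-- The two summands count the two kinds of exceptional clique in `card_cl_le_of_far_notMem`; the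
right side is a geometric share of a lower bound for the extremal count. -/
lemma choose_mul_choose_le_of_small {r k t n i : ℕ} (ht : t + 1 ≤ k) (hi : 2 ≤ i) (hir : i ≤ r)
    (hn : 4 * (Real.exp 1 * (r : ℝ)) ^ (t + 2) * (k : ℝ) ≤ n) :
    ((i * (k + 1) - 1).choose (t + i) : ℝ) * n.choose (r - i) +
      k.choose (t + 1) * (r * k + i - 1).choose (i - 1) * n.choose (r - i) ≤
      3 / 4 * (1 / 4) ^ (i - 2) * (k.choose (t + 1) * (n - k).choose (r - 1)) := by
  obtain ⟨he1, he2⟩ := exp_one_bounds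
  have hk1 : (1 : ℝ) ≤ k := by exact_mod_cast (show 1 ≤ k by omega)
  have hr2 : (2 : ℝ) ≤ r := by exact_mod_cast (show 2 ≤ r by omega)
  have her : 1 ≤ Real.exp 1 * r := by nlinarith
  have hx2 : (Real.exp 1 * r) ^ 2 ≤ (Real.exp 1 * r) ^ (t + 2) :=
    pow_le_pow_right₀ her (by omega)
  -- 28 = 4 · 7, with e² > 7.
  have hlow : 28 * ((r : ℝ) ^ 2 * k) ≤ n := by
    have h1 : 7 * (r : ℝ) ^ 2 ≤ (Real.exp 1 * r) ^ 2 := by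
      rw [mul_pow]; gcongr; nlinarith
    calc 28 * ((r : ℝ) ^ 2 * k) = 4 * (7 * (r : ℝ) ^ 2) * k := by ring
      _ ≤ 4 * (Real.exp 1 * (r : ℝ)) ^ (t + 2) * (k : ℝ) := by
          gcongr; exact h1.trans hx2
      _ ≤ n := hn
  have hlowN : 28 * (r ^ 2 * k) ≤ n := by exact_mod_cast hlow
  have hrk : 0 < r ^ 2 * k := Nat.mul_pos (pow_pos (by omega) 2) (by omega)
  have hnpos : 0 < n := by omega
  have hn0 : (0 : ℝ) < n := by exact_mod_cast hnpos
  have h16 : 16 * ((r - 1) * (k + (r - 1))) ≤ n := by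
    have h1 : k + (r - 1) ≤ r * k := by
      obtain ⟨r, rfl⟩ : ∃ r', r = r' + 1 := ⟨r - 1, by omega⟩
      simp only [Nat.add_sub_cancel]
      have : r * 1 ≤ r * k := Nat.mul_le_mul_left _ (by omega)
      rw [Nat.add_mul]; omega
    have h2 : (r - 1) * (k + (r - 1)) ≤ r * (r * k) := Nat.mul_le_mul (by omega) h1
    have h3 : r * (r * k) = r ^ 2 * k := by ring
    omega
  have hE := choose_sub_le (l := i - 1) hnpos (show i - 1 ≤ r - 1 by omega)
    (show r - 1 ≤ r by omega) h16
  rw [show r - 1 - (i - 1) = r - i by omega] at hE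
  obtain ⟨l, rfl⟩ : ∃ l, i = l + 2 := ⟨i - 2, by omega⟩
  rw [show l + 2 - 1 = l + 1 by omega] at hE ⊢
  rw [show l + 2 - 2 = l by omega, show r * k + (l + 2) - 1 = r * k + (l + 1) by omega]
  set M : ℝ := (((n - k).choose (r - 1) : ℕ) : ℝ)
  have hM0 : 0 ≤ M := by positivity
  have hC0 : (0 : ℝ) ≤ k.choose (t + 1) := by positivity
  have hrn : (r : ℝ) * k / n ≤ r / (4 * (Real.exp 1 * r) ^ (t + 2)) := by
    rw [div_le_div_iff₀ hn0 (by positivity)]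
    calc (r : ℝ) * k * (4 * (Real.exp 1 * r) ^ (t + 2))
        = r * (4 * (Real.exp 1 * r) ^ (t + 2) * k) := by ring
      _ ≤ r * n := by gcongr
  have ht1 : (0 : ℝ) < (t : ℝ) + 1 := by positivity
  -- As t + 1 ≤ k, the ratio of top to bottom is at most (l + 2)k/(t + 1). Then t + 1 factors k/(t +
  -- 1) are absorbed into C(k, t + 1), and l + 1 factors are bounded by k.
  have hA : (((l + 2) * (k + 1) - 1).choose (t + (l + 2)) : ℝ) ≤
      (Real.exp 1 * (l + 2 : ℝ)) ^ (t + 2 + l) * (k.choose (t + 1) * (k : ℝ) ^ (l + 1)) := by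
    have h1 := choose_le_exp_mul_div_pow ((l + 2) * (k + 1) - 1) (show 1 ≤ t + (l + 2) by omega)
    have h2 : ((((l + 2) * (k + 1) - 1 : ℕ) : ℝ)) / ((t + (l + 2) : ℕ) : ℝ) ≤
        (l + 2) * (k / (t + 1)) := by
      rw [← mul_div_assoc, div_le_div_iff₀ (by positivity) ht1]
      have h3 : ((((l + 2) * (k + 1) - 1 : ℕ) : ℝ)) ≤ (l + 2) * (k + 1) := by
        have : (l + 2) * (k + 1) - 1 ≤ (l + 2) * (k + 1) := by omega
        exact_mod_cast this
      have h4 : ((k : ℝ) + 1) * (t + 1) ≤ k * (t + (l + 2)) := by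
        have : (t : ℝ) + 1 ≤ k := by exact_mod_cast ht
        have : (0 : ℝ) ≤ k * l := by positivity
        nlinarith
      push_cast
      calc _ ≤ ((l : ℝ) + 2) * (k + 1) * (t + 1) := by gcongr
        _ = (l + 2) * ((k + 1) * (t + 1)) := by ring
        _ ≤ (l + 2) * (k * (t + (l + 2))) := by gcongr
        _ = _ := by ring
    have h5 := div_pow_le_choose ht
    push_cast at h5
    calc _ ≤ _ := h1
      _ ≤ (Real.exp 1 * ((l + 2) * (k / (t + 1)))) ^ (t + (l + 2)) := by
          rw [mul_div_assoc]; gcongr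
      _ = (Real.exp 1 * (l + 2 : ℝ)) ^ (t + 2 + l) *
          ((k / (t + 1) : ℝ) ^ (t + 1) * (k / (t + 1) : ℝ) ^ (l + 1)) := by
          rw [← mul_assoc, mul_pow, ← pow_add]
          congr 2 <;> ring
      _ ≤ _ := by
          gcongr
          exact div_le_self (by positivity) (by linarith [(Nat.cast_nonneg t : (0 : ℝ) ≤ t)])
  have hB : ((r * k + (l + 1)).choose (l + 1) : ℝ) ≤ (2 * (r * k) : ℝ) ^ (l + 1) := by
    have h1 := Nat.choose_add_le_add_one_pow (r * k) (l + 1)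
    have h2 : ((r * k + (l + 1)).choose (l + 1) : ℝ) ≤ ((r : ℝ) * k + 1) ^ (l + 1) := by
      exact_mod_cast h1
    refine h2.trans ?_
    gcongr
    nlinarith
  have hfirst : (((l + 2) * (k + 1) - 1).choose (t + (l + 2)) : ℝ) * n.choose (r - (l + 2)) ≤
      8 / 15 * (1 / 4) ^ l * (k.choose (t + 1) * M) := by
    calc _ ≤ ((Real.exp 1 * (l + 2 : ℝ)) ^ (t + 2 + l) * (k.choose (t + 1) * (k : ℝ) ^ (l + 1))) *
          (16 / 15 * ((r : ℝ) / n) ^ (l + 1) * M) := by gcongr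
      _ = 16 / 15 * ((Real.exp 1 * (l + 2 : ℝ)) ^ (t + 2 + l) * ((r : ℝ) * k / n) ^ (l + 1)) *
          (k.choose (t + 1) * M) := by
          rw [mul_div_right_comm, mul_pow]; ring
      _ ≤ 16 / 15 * ((Real.exp 1 * (l + 2 : ℝ)) ^ (t + 2 + l) *
          ((r : ℝ) / (4 * (Real.exp 1 * r) ^ (t + 2))) ^ (l + 1)) * (k.choose (t + 1) * M) := by
          gcongr
      _ ≤ 16 / 15 * (1 / 2 * (1 / 4) ^ l) * (k.choose (t + 1) * M) := by
          exact mul_le_mul_of_nonneg_right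
            (mul_le_mul_of_nonneg_left (exp_mul_pow_mul_le hir) (by norm_num)) (by positivity)
      _ = _ := by ring
  have hsecond : (k.choose (t + 1) * (r * k + (l + 1)).choose (l + 1) * n.choose (r - (l + 2)) : ℝ)
      ≤ 8 / 105 * (1 / 4) ^ l * (k.choose (t + 1) * M) := by
    have hq : 2 * ((r : ℝ) ^ 2 * k) / n ≤ 1 / 14 := by
      rw [div_le_iff₀ hn0]; linarith
    calc _ ≤ (k.choose (t + 1) * (2 * (r * k) : ℝ) ^ (l + 1)) *
          (16 / 15 * ((r : ℝ) / n) ^ (l + 1) * M) := by gcongr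
      _ = 16 / 15 * (2 * ((r : ℝ) ^ 2 * k) / n) ^ (l + 1) * (k.choose (t + 1) * M) := by
          have : (2 * ((r : ℝ) ^ 2 * k) / n) = (2 * (r * k) : ℝ) * (r / n) := by ring
          rw [this, mul_pow _ ((r : ℝ) / n)]; ring
      _ ≤ 16 / 15 * (1 / 14) ^ (l + 1) * (k.choose (t + 1) * M) := by gcongr
      _ = 8 / 105 * (1 / 14) ^ l * (k.choose (t + 1) * M) := by ring
      _ ≤ _ := by gcongr; norm_num
  -- 8/15 + 8/105 = 64/105 ≤ 3/4.
  have hpos : 0 ≤ (1 / 4 : ℝ) ^ l * (k.choose (t + 1) * M) := by positivity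
  linarith

lemma choose_mul_choose_le_of_medium {r k t n a i : ℕ} (hk : 1 ≤ k) (ha : 2 ≤ a)
    (ht : (a - 1) * k ≤ t) (hi : a + 1 ≤ i) (hir : i ≤ r)
    (hn : 4 * (r : ℝ) ^ 2 * (k : ℝ) * (Real.exp 1 * (r : ℝ) / ((a : ℝ) - 1)) ^ (t + a) ≤ n) :
    ((i * (k + 1) - 1).choose (t + i) : ℝ) * n.choose (r - i) ≤
      3 / 4 * (1 / 4) ^ (i - (a + 1)) * (n - (r * k + r)).choose (r - a) := by
  obtain ⟨he1, he2⟩ := exp_one_bounds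
  have hk1 : (1 : ℝ) ≤ k := by exact_mod_cast hk
  have ha2 : (2 : ℝ) ≤ a := by exact_mod_cast ha
  have har : (a : ℝ) + 1 ≤ r := by exact_mod_cast hi.trans hir
  have ha1 : (0 : ℝ) < (a : ℝ) - 1 := by linarith
  have hr0 : (0 : ℝ) < r := by linarith
  have htR : ((a : ℝ) - 1) * k ≤ t := by
    have : ((a - 1 : ℕ) : ℝ) * k ≤ t := by exact_mod_cast ht
    rwa [Nat.cast_sub (by omega), Nat.cast_one] at this
  set B := Real.exp 1 * (r : ℝ) / ((a : ℝ) - 1) with hBdef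
  have hBe : Real.exp 1 ≤ B := by
    rw [hBdef, le_div_iff₀ ha1]; gcongr; linarith
  have hB0 : 0 < B := by linarith
  have hta : 3 ≤ t + a := by
    have : 1 * 1 ≤ (a - 1) * k := Nat.mul_le_mul (by omega) hk
    omega
  have hBp : 12 ≤ B ^ (t + a) := by
    calc (12 : ℝ) ≤ 2.7 ^ 3 := by norm_num
      _ ≤ B ^ 3 := by gcongr; linarith
      _ ≤ B ^ (t + a) := pow_le_pow_right₀ (by linarith) hta
  have hlow : 48 * ((r : ℝ) ^ 2 * k) ≤ n := by
    refine le_trans ?_ hn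
    have : (0 : ℝ) ≤ (r : ℝ) ^ 2 * k := by positivity
    nlinarith
  have hlowN : 48 * (r ^ 2 * k) ≤ n := by exact_mod_cast hlow
  have hrk : 0 < r ^ 2 * k := Nat.mul_pos (pow_pos (by omega) 2) (by omega)
  have hnpos : 0 < n := by omega
  have hn0 : (0 : ℝ) < n := by exact_mod_cast hnpos
  have h16 : 16 * ((r - a) * (r * k + r + (r - a))) ≤ n := by
    have h1 : r * k + r + (r - a) ≤ 3 * (r * k) := by
      have : r * 1 ≤ r * k := Nat.mul_le_mul_left _ hk
      omega
    have h2 : (r - a) * (r * k + r + (r - a)) ≤ r * (3 * (r * k)) := Nat.mul_le_mul (by omega) h1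
    have h3 : r * (3 * (r * k)) = 3 * (r ^ 2 * k) := by ring
    omega
  obtain ⟨l, rfl⟩ : ∃ l, i = a + 1 + l := ⟨i - (a + 1), by omega⟩
  have hE := choose_sub_le (l := l + 1) hnpos (show l + 1 ≤ r - a by omega)
    (show r - a ≤ r by omega) h16
  rw [show r - a - (l + 1) = r - (a + 1 + l) by omega] at hE
  rw [show a + 1 + l - (a + 1) = l by omega]
  set M : ℝ := (((n - (r * k + r)).choose (r - a) : ℕ) : ℝ)
  have hM0 : 0 ≤ M := by positivity
  have hA : (((a + 1 + l) * (k + 1) - 1).choose (t + (a + 1 + l)) : ℝ) ≤ B ^ (t + a + (l + 1)) := by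
    have h1 := choose_le_exp_mul_div_pow ((a + 1 + l) * (k + 1) - 1)
      (show 1 ≤ t + (a + 1 + l) by omega)
    rw [show t + a + (l + 1) = t + (a + 1 + l) by omega]
    refine h1.trans ?_
    gcongr
    rw [hBdef, div_le_div_iff₀ (by positivity) ha1, mul_assoc, mul_assoc]
    refine mul_le_mul_of_nonneg_left ?_ (by positivity)
    have h3 : ((((a + 1 + l) * (k + 1) - 1 : ℕ) : ℝ)) ≤ (a + 1 + l) * (k + 1) := by
      have : (a + 1 + l) * (k + 1) - 1 ≤ (a + 1 + l) * (k + 1) := by omega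
      exact_mod_cast this
    have hir' : (a : ℝ) + 1 + l ≤ r := by exact_mod_cast hir
    push_cast
    calc _ ≤ ((a : ℝ) + 1 + l) * (k + 1) * (a - 1) := by gcongr
      _ = (a + 1 + l) * ((a - 1) * k + (a - 1)) := by ring
      _ ≤ r * (t + (a + 1 + l)) := by
          have : (0 : ℝ) ≤ l := by positivity
          have hak : 0 ≤ ((a : ℝ) - 1) * k := by positivity
          gcongr
          linarith
  -- A single factor Br/n pays for the whole of B^(t + a), by the lower bound on n. The constants
  -- then close because (16/15)(e/4) < 3/4.
  have hx : B ^ (t + a) * (B * (r / n)) ≤ Real.exp 1 / 4 := by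
    have h1 : B ^ (t + a) * (B * (r / n)) = B * r * B ^ (t + a) / n := by ring
    rw [h1, div_le_iff₀ hn0]
    have h2 : B * r ≤ Real.exp 1 * (r ^ 2 * k) := by
      have : B ≤ Real.exp 1 * r := div_le_self (by positivity) (by linarith)
      calc B * r ≤ Real.exp 1 * r * r * 1 := by rw [mul_one]; gcongr
        _ ≤ Real.exp 1 * r * r * k := by gcongr
        _ = _ := by ring
    calc B * r * B ^ (t + a) ≤ Real.exp 1 * (r ^ 2 * k) * B ^ (t + a) := by gcongr
      _ = Real.exp 1 / 4 * (4 * (r : ℝ) ^ 2 * k * B ^ (t + a)) := by ring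
      _ ≤ _ := by gcongr
  have hy : B * (r / n) ≤ 1 / 4 := by
    have : 0 ≤ B * (r / n) := by positivity
    nlinarith
  calc _ ≤ B ^ (t + a + (l + 1)) * (16 / 15 * ((r : ℝ) / n) ^ (l + 1) * M) := by gcongr
    _ = 16 / 15 * (B ^ (t + a) * (B * (r / n))) * (B * (r / n)) ^ l * M := by
        rw [pow_add, pow_succ, pow_succ, mul_pow]; ring
    _ ≤ 16 / 15 * (Real.exp 1 / 4) * (1 / 4) ^ l * M := by gcongr
    _ ≤ 3 / 4 * (1 / 4) ^ l * M := by
        gcongr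
        linarith

/-! ### Counting concentrated sets, and the middle range -/

/-- The `s`-subsets of `range n` with at least `q` elements below `p`. -/
def heavy (n s p q : ℕ) : Finset (Finset ℕ) :=
  ((range n).powersetCard s).filter fun K => q ≤ cnt K p

lemma mem_heavy {n s p q : ℕ} {K : Finset ℕ} :
    K ∈ heavy n s p q ↔ K ⊆ range n ∧ K.card = s ∧ q ≤ cnt K p := by
  simp [heavy, mem_powersetCard, and_assoc]

/-- Such a set is a union of x elements below p, y further elements below p', and an arbitrary
remainder; overcounting is harmless. -/
lemma card_filter_two_cnt_le (n s p x p' y : ℕ) (hp : p ≤ p') :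
    (((range n).powersetCard s).filter fun K => x ≤ cnt K p ∧ x + y ≤ cnt K p').card ≤
      p.choose x * p'.choose y * n.choose (s - (x + y)) := by
  have hsub : (((range n).powersetCard s).filter fun K => x ≤ cnt K p ∧ x + y ≤ cnt K p') ⊆
      image₂ (· ∪ ·) (image₂ (· ∪ ·) ((range p).powersetCard x) ((range p').powersetCard y))
        ((range n).powersetCard (s - (x + y))) := by
    intro K hK
    rw [mem_filter, mem_powersetCard] at hK
    obtain ⟨⟨hKn, hKs⟩, h1, h2⟩ := hK
    obtain ⟨A, hA, hAx⟩ := exists_subset_card_eq h1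
    have hAK : A ⊆ K.filter (· < p') := fun z hz => by
      have := hA hz
      rw [mem_filter] at this ⊢
      exact ⟨this.1, by omega⟩
    have h3 : y ≤ (K.filter (· < p') \ A).card := by
      rw [card_sdiff_of_subset hAK]
      have : x + y ≤ (K.filter (· < p')).card := h2
      omega
    obtain ⟨B, hB, hBy⟩ := exists_subset_card_eq h3
    have hAB : Disjoint A B := (disjoint_of_subset_left hB sdiff_disjoint).symm
    have hABK : A ∪ B ⊆ K :=
      union_subset (hA.trans (filter_subset _ _)) (hB.trans (sdiff_subset.trans (filter_subset _ _)))
    refine mem_image₂.2 ⟨A ∪ B, mem_image₂.2 ⟨A, ?_, B, ?_, rfl⟩, K \ (A ∪ B), ?_,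
      union_sdiff_of_subset hABK⟩
    · exact mem_powersetCard.2 ⟨fun z hz => mem_range.2 (mem_filter.1 (hA hz)).2, hAx⟩
    · exact mem_powersetCard.2
        ⟨fun z hz => mem_range.2 (mem_filter.1 (mem_sdiff.1 (hB hz)).1).2, hBy⟩
    · rw [mem_powersetCard, card_sdiff_of_subset hABK, card_union_of_disjoint hAB, hKs, hAx, hBy]
      exact ⟨sdiff_subset.trans hKn, rfl⟩
  refine (card_le_card hsub).trans ((card_image₂_le _ _ _).trans ?_)
  rw [card_powersetCard, card_range]
  refine Nat.mul_le_mul_right _ ((card_image₂_le _ _ _).trans ?_)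
  simp

lemma card_heavy_le (n s p q : ℕ) : (heavy n s p q).card ≤ p.choose q * n.choose (s - q) := by
  have := card_filter_two_cnt_le n s p q p 0 le_rfl
  simpa [heavy] using this

/-- The clique bound in the middle range, for down-closed families. -/
lemma card_cl_le_of_medium {r k t n a : ℕ} {H : Set (Finset ℕ)} (hk : 1 ≤ k) (ha : 2 ≤ a)
    (har : a + 1 ≤ r) (hat : (a - 1) * k ≤ t) (hta : t + 1 ≤ a * k) (hD : DownClosed H)
    (hM : MatchFree k H)
    (hn : 4 * (r : ℝ) ^ 2 * (k : ℝ) * (Real.exp 1 * (r : ℝ) / ((a : ℝ) - 1)) ^ (t + a) ≤ n) :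
    (cl r n (t + r) H).card ≤ (heavy n (t + r) (a * k + a - 1) (t + a)).card := by
  by_cases hW : Ico (a * k - 1) (a * k + a - 1) ∪ Ico (r * k + a) (r * k + r) ∈ H
  · refine card_le_card fun K hK => ?_
    obtain ⟨h1, h2, h3⟩ := mem_cl.1 hK
    exact mem_heavy.2 ⟨h1, h2, le_cnt_of_far_mem (by omega) (by omega) hta hD hM hW h2 h3⟩
  have hpq : a * k ≤ r * k := Nat.mul_le_mul_right _ (by omega)
  have hgap : ∀ p q D, p ≤ a * k + a - 1 → q ≤ a * k + a - 1 →
      D ∈ (Ico (r * k + r) n).powersetCard (r - a) → Disjoint (Ico p q) D := by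
    intro p q D hp hq hD
    rw [Finset.disjoint_left]; intro x hx hx'
    have := (mem_powersetCard.1 hD).1 hx'
    simp only [mem_Ico] at hx this
    omega
  -- The last t + a core vertices together with r - a vertices beyond rk + r. These sets are heavy,
  -- but each contains an r-set that would push down to the missing edge W.
  set G := ((Ico (r * k + r) n).powersetCard (r - a)).image
    fun D => Ico (a * k - 1 - t) (a * k + a - 1) ∪ D with hG
  have hGc : G.card = (n - (r * k + r)).choose (r - a) := by
    rw [hG, card_image_of_injOn, card_powersetCard, Nat.card_Ico]
    intro D hD D' hD' h
    have h1 := union_sdiff_cancel_left (hgap _ _ D (by omega : a * k - 1 - t ≤ _) le_rfl hD)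
    have h2 := union_sdiff_cancel_left (hgap _ _ D' (by omega : a * k - 1 - t ≤ _) le_rfl hD')
    simp only at h
    rw [← h1, ← h2, h]
  have hGcl : ∀ K ∈ G, K ∉ cl r n (t + r) H := by
    intro K hK hKcl
    obtain ⟨D, hDm, rfl⟩ := mem_image.1 hK
    have hdE := hgap (a * k - 1) _ D (by omega) le_rfl hDm
    obtain ⟨hD1, hD2⟩ := mem_powersetCard.1 hDm
    have hdW : Disjoint (Ico (a * k - 1) (a * k + a - 1)) (Ico (r * k + a) (r * k + r)) := by
      rw [Finset.disjoint_left]; intro x; simp only [mem_Ico]; omega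
    have hE : Ico (a * k - 1) (a * k + a - 1) ∪ D ∈ H := by
      refine (mem_cl.1 hKcl).2.2 _ (union_subset_union ?_ Subset.rfl) ?_
      · intro x; simp only [mem_Ico]; omega
      · rw [card_union_of_disjoint hdE, hD2, Nat.card_Ico]; omega
    refine hW (hD _ hE _ ?_ fun m => ?_)
    · rw [card_union_of_disjoint hdE, card_union_of_disjoint hdW, hD2, Nat.card_Ico, Nat.card_Ico]
      omega
    · rw [cnt_union hdE, cnt_union hdW, cnt_Ico (r * k + a)]
      have h1 := cnt_le_card D m
      have h2 : m ≤ r * k + r → cnt D m = 0 := fun hm => by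
        rw [cnt, card_eq_zero, filter_eq_empty_iff]
        intro x hx
        have := hD1 hx
        rw [mem_Ico] at this
        omega
      omega
  have hGsub : G ⊆ heavy n (t + r) (a * k + a - 1) (t + a) := by
    intro K hK
    obtain ⟨D, hDm, rfl⟩ := mem_image.1 hK
    have hd := hgap (a * k - 1 - t) _ D (by omega) le_rfl hDm
    obtain ⟨hD1, hD2⟩ := mem_powersetCard.1 hDm
    have hDne : D.Nonempty := card_pos.1 (by omega)
    obtain ⟨x, hx⟩ := hDne
    have hxn := mem_Ico.1 (hD1 hx)
    refine mem_heavy.2 ⟨union_subset (fun z => ?_) (fun z hz => ?_), ?_, ?_⟩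
    · simp only [mem_Ico, mem_range]; omega
    · have := hD1 hz
      simp only [mem_Ico, mem_range] at this ⊢; omega
    · rw [card_union_of_disjoint hd, hD2, Nat.card_Ico]; omega
    · rw [cnt_union hd, cnt_Ico]; omega
  have hcover : cl r n (t + r) H ⊆ (heavy n (t + r) (a * k + a - 1) (t + a) \ G) ∪
      (Icc (a + 1) r).biUnion fun i => heavy n (t + r) (i * (k + 1) - 1) (t + i) := by
    intro K hK
    obtain ⟨h1, h2, h3⟩ := mem_cl.1 hK
    obtain ⟨i, hi1, hir, hi⟩ := exists_le_cnt_of_clique hD hM h2 h3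
    have hself := cnt_le_self K (i * (k + 1) - 1)
    -- From t + i ≤ i(k + 1) - 1 one gets ik > t ≥ (a - 1)k.
    have hai : a ≤ i := by
      by_contra hlt
      have : i * k ≤ (a - 1) * k := Nat.mul_le_mul_right _ (by omega)
      have : i * (k + 1) = i * k + i := by ring
      omega
    rw [mem_union]
    rcases Nat.eq_or_lt_of_le hai with rfl | hlt
    · left
      rw [mem_sdiff]
      exact ⟨mem_heavy.2 ⟨h1, h2, hi⟩, fun hKG => hGcl K hKG hK⟩
    · right
      exact mem_biUnion.2 ⟨i, mem_Icc.2 ⟨hlt, hir⟩, mem_heavy.2 ⟨h1, h2, hi⟩⟩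
  have hsum : ∑ i ∈ Icc (a + 1) r, (heavy n (t + r) (i * (k + 1) - 1) (t + i)).card ≤ G.card := by
    have : (∑ i ∈ Icc (a + 1) r, ((heavy n (t + r) (i * (k + 1) - 1) (t + i)).card : ℝ)) ≤
        G.card := by
      rw [hGc]
      refine sum_le_of_geometric (by positivity) fun i hi => ?_
      rw [mem_Icc] at hi
      refine le_trans ?_ (choose_mul_choose_le_of_medium hk ha hat hi.1 hi.2 hn)
      have h := card_heavy_le n (t + r) (i * (k + 1) - 1) (t + i)
      rw [show t + r - (t + i) = r - i by omega] at h
      exact_mod_cast h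
    exact_mod_cast this
  have h1 := card_le_card hcover
  have h2 := card_union_le (heavy n (t + r) (a * k + a - 1) (t + a) \ G)
    ((Icc (a + 1) r).biUnion fun i => heavy n (t + r) (i * (k + 1) - 1) (t + i))
  have h3 := card_biUnion_le (s := Icc (a + 1) r)
    (t := fun i => heavy n (t + r) (i * (k + 1) - 1) (t + i))
  have h4 := card_sdiff_of_subset hGsub
  have h5 := card_le_card hGsub
  omega

/-! ### Small cliques: the case of a missing far edge -/

/-- Without a far edge, every clique has two elements more than expected in an initial segment. -/
lemma exists_le_cnt_of_far_notMem {r k t x : ℕ} {H : Set (Finset ℕ)} (hr : 1 ≤ r) (hD : DownClosed H)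
    (hxt : x ≤ t) (htk : t ≤ r * k) (hfar : insert x (Ico (r * k + 1) (r * k + r)) ∉ H)
    {K : Finset ℕ} (hc : K.card = t + r) (hK : ∀ E ⊆ K, E.card = r → E ∈ H) :
    ∃ i, 2 ≤ i ∧ i ≤ r ∧ t + i ≤ cnt K (r * k + i - 1) := by
  obtain ⟨T, hTK, hTr, hT⟩ := exists_top hc
  have hx : x ∉ Ico (r * k + 1) (r * k + r) := by rw [mem_Ico]; omega
  -- If T were above the far set, that set would be an edge. At a violating m we have m > t ≥ x, as
  -- t elements of K precede T, so x is counted; hence T has at least two elements below m.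
  have hm : ∃ m, cnt (insert x (Ico (r * k + 1) (r * k + r))) m < cnt T m := by
    by_contra hcon
    push Not at hcon
    refine hfar (hD T (hK T hTK hTr) _ ?_ hcon)
    rw [card_insert_of_notMem hx, Nat.card_Ico]; omega
  obtain ⟨m, hm⟩ := hm
  have h1 := (hT m).resolve_left (by omega)
  have h2 := cnt_le_self K m
  have h3 : cnt (insert x (Ico (r * k + 1) (r * k + r))) m = 1 + (min (r * k + r) m - (r * k + 1)) := by
    rw [insert_eq, cnt_union (disjoint_singleton_left.2 hx), cnt_Ico, cnt,
      filter_true_of_mem (by simp; omega), card_singleton]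
  have h4 : cnt T m ≤ r := hTr ▸ cnt_le_card T m
  refine ⟨cnt T m, by omega, h4, ?_⟩
  have h5 := cnt_mono K (show m ≤ r * k + cnt T m - 1 by omega)
  omega

/-- Only the sets with exactly t + 1 core vertices are counted; this is enough to compare with. -/
lemma choose_mul_choose_le_card_heavy {n k t r : ℕ} (hr : 1 ≤ r) (hkn : k ≤ n) :
    k.choose (t + 1) * (n - k).choose (r - 1) ≤ (heavy n (t + r) k (t + 1)).card := by
  have hd : ∀ A ∈ (range k).powersetCard (t + 1), ∀ D ∈ (Ico k n).powersetCard (r - 1),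
      (∀ x ∈ A, x < k) ∧ (∀ x ∈ D, k ≤ x ∧ x < n) ∧ Disjoint A D := by
    intro A hA D hD
    have h1 : ∀ x ∈ A, x < k := fun x hx => mem_range.1 ((mem_powersetCard.1 hA).1 hx)
    have h2 : ∀ x ∈ D, k ≤ x ∧ x < n := fun x hx => mem_Ico.1 ((mem_powersetCard.1 hD).1 hx)
    refine ⟨h1, h2, Finset.disjoint_left.2 fun x hx hx' => ?_⟩
    have := h1 x hx
    have := h2 x hx'
    omega
  have hfilter : ∀ A ∈ (range k).powersetCard (t + 1), ∀ D ∈ (Ico k n).powersetCard (r - 1),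
      (A ∪ D).filter (· < k) = A := by
    intro A hA D hD
    obtain ⟨h1, h2, -⟩ := hd A hA D hD
    ext x
    simp only [mem_filter, mem_union]
    constructor
    · rintro ⟨h | h, hx⟩
      · exact h
      · have := h2 x h; omega
    · exact fun h => ⟨Or.inl h, h1 x h⟩
  rw [← card_range k, ← card_powersetCard, card_range, ← Nat.card_Ico, ← card_powersetCard,
    ← card_product]
  refine card_le_card_of_injOn (fun p => p.1 ∪ p.2) (fun p hp => ?_) (fun p hp p' hp' h => ?_)
  · obtain ⟨hA, hD⟩ := mem_product.1 hp
    obtain ⟨h1, h2, h3⟩ := hd _ hA _ hD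
    refine mem_heavy.2 ⟨fun x hx => ?_, ?_, ?_⟩
    · rw [mem_range]
      rcases mem_union.1 hx with h | h
      · exact (h1 x h).trans_le hkn
      · exact (h2 x h).2
    · rw [card_union_of_disjoint h3, (mem_powersetCard.1 hA).2, (mem_powersetCard.1 hD).2]; omega
    · rw [cnt, hfilter _ hA _ hD, (mem_powersetCard.1 hA).2]
  · obtain ⟨hA, hD⟩ := mem_product.1 hp
    obtain ⟨hA', hD'⟩ := mem_product.1 hp'
    simp only at h
    have e1 : p.1 = p'.1 := by
      rw [← hfilter _ hA _ hD, ← hfilter _ hA' _ hD', h]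
    have e2 : p.2 = p'.2 := by
      have h1 := union_sdiff_cancel_left (hd _ hA _ hD).2.2
      have h2 := union_sdiff_cancel_left (hd _ hA' _ hD').2.2
      rw [← h1, ← h2, h, e1]
    exact Prod.ext e1 e2

/-- The clique bound in the absence of far edges. -/
lemma card_cl_le_of_far_notMem {r k t n x : ℕ} {H : Set (Finset ℕ)} (hr : 1 ≤ r) (htk : t + 1 ≤ k)
    (hD : DownClosed H) (hM : MatchFree k H) (hxt : x ≤ t)
    (hfar : insert x (Ico (r * k + 1) (r * k + r)) ∉ H)
    (hn : 4 * (Real.exp 1 * (r : ℝ)) ^ (t + 2) * (k : ℝ) ≤ n) :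
    (cl r n (t + r) H).card ≤ (heavy n (t + r) k (t + 1)).card := by
  have hkr : k ≤ r * k := Nat.le_mul_of_pos_left k hr
  have hkn : k ≤ n := by
    obtain ⟨he1, -⟩ := exp_one_bounds
    have hr1 : (1 : ℝ) ≤ r := by exact_mod_cast hr
    have h1 : 1 ≤ (Real.exp 1 * (r : ℝ)) ^ (t + 2) := one_le_pow₀ (by nlinarith)
    have : (k : ℝ) ≤ n := by
      refine le_trans ?_ hn
      have : (0 : ℝ) ≤ k := by positivity
      nlinarith
    exact_mod_cast this
  refine le_trans ?_ (choose_mul_choose_le_card_heavy hr hkn)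
  -- The first family takes the cliques concentrated with index at least 2. A clique of index 1 has
  -- t + 1 vertices among the first k, and the missing far edge gives it a further excess of i - 1,
  -- so it falls in the second.
  let F : ℕ → Finset (Finset ℕ) := fun i => heavy n (t + r) (i * (k + 1) - 1) (t + i) ∪
    ((range n).powersetCard (t + r)).filter
      fun K => t + 1 ≤ cnt K k ∧ t + 1 + (i - 1) ≤ cnt K (r * k + i - 1)
  have hcover : cl r n (t + r) H ⊆ (Icc 2 r).biUnion F := by
    intro K hK
    obtain ⟨h1, h2, h3⟩ := mem_cl.1 hK
    obtain ⟨i, hi1, hir, hi⟩ := exists_le_cnt_of_clique hD hM h2 h3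
    rcases Nat.eq_or_lt_of_le hi1 with rfl | hlt
    · obtain ⟨j, hj1, hjr, hj⟩ := exists_le_cnt_of_far_notMem hr hD hxt (by omega) hfar h2 h3
      rw [show 1 * (k + 1) - 1 = k by omega] at hi
      refine mem_biUnion.2 ⟨j, mem_Icc.2 ⟨hj1, hjr⟩, mem_union_right _ (mem_filter.2
        ⟨mem_powersetCard.2 ⟨h1, h2⟩, hi, ?_⟩)⟩
      rwa [show t + 1 + (j - 1) = t + j by omega]
    · exact mem_biUnion.2 ⟨i, mem_Icc.2 ⟨hlt, hir⟩, mem_union_left _ (mem_heavy.2 ⟨h1, h2, hi⟩)⟩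
  have hsum : ∑ i ∈ Icc 2 r, ((F i).card : ℝ) ≤ k.choose (t + 1) * (n - k).choose (r - 1) := by
    refine sum_le_of_geometric (by positivity) fun i hi => ?_
    rw [mem_Icc] at hi
    refine le_trans ?_ (choose_mul_choose_le_of_small htk hi.1 hi.2 hn)
    have h1 := card_heavy_le n (t + r) (i * (k + 1) - 1) (t + i)
    have h2 := card_filter_two_cnt_le n (t + r) k (t + 1) (r * k + i - 1) (i - 1) (by omega)
    rw [show t + r - (t + i) = r - i by omega] at h1
    rw [show t + r - (t + 1 + (i - 1)) = r - i by omega] at h2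
    have h3 := (card_union_le _ _).trans (Nat.add_le_add h1 h2)
    exact_mod_cast h3
  have h1 := (card_le_card hcover).trans card_biUnion_le
  have h2 : ∑ i ∈ Icc 2 r, (F i).card ≤ k.choose (t + 1) * (n - k).choose (r - 1) := by
    exact_mod_cast hsum
  exact h1.trans h2

/-! ### Small cliques: induction by deleting vertex zero -/

/-- The translate of a set of naturals by one. -/
def up (K : Finset ℕ) : Finset ℕ := K.map (addRightEmbedding 1)

lemma mem_up {K : Finset ℕ} {x : ℕ} : x ∈ up K ↔ ∃ y ∈ K, y + 1 = x := by simp [up]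

lemma zero_notMem_up (K : Finset ℕ) : 0 ∉ up K := by simp [mem_up]

lemma succ_mem_up {K : Finset ℕ} {x : ℕ} : x + 1 ∈ up K ↔ x ∈ K := by simp [mem_up]

lemma card_up (K : Finset ℕ) : (up K).card = K.card := card_map _

lemma up_injective : Function.Injective up := map_injective _

lemma up_subset {E K : Finset ℕ} : up E ⊆ up K ↔ E ⊆ K := map_subset_map

lemma cnt_up (K : Finset ℕ) (p : ℕ) : cnt (up K) (p + 1) = cnt K p := by
  have : (up K).filter (· < p + 1) = up (K.filter (· < p)) := by
    ext x
    rcases x with _ | x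
    · simp [zero_notMem_up]
    · simp [succ_mem_up]
  rw [cnt, this, card_up]

lemma cnt_insert_zero_up (K : Finset ℕ) (p : ℕ) : cnt (insert 0 (up K)) (p + 1) = cnt K p + 1 := by
  rw [cnt, filter_insert, if_pos (Nat.succ_pos p), card_insert_of_notMem (by
    simp [zero_notMem_up]), ← cnt_up]

lemma exists_up_eq {n : ℕ} {K : Finset ℕ} (h0 : 0 ∉ K) (hK : K ⊆ range (n + 1)) :
    ∃ K' ⊆ range n, up K' = K := by
  refine ⟨(range n).filter (· + 1 ∈ K), filter_subset _ _, ?_⟩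
  ext x
  rcases x with _ | x
  · simp [zero_notMem_up, h0]
  · rw [succ_mem_up, mem_filter, mem_range]
    refine ⟨fun h => h.2, fun h => ⟨?_, h⟩⟩
    have := mem_range.1 (hK h)
    omega

lemma up_subset_range {n : ℕ} {K : Finset ℕ} (h : K ⊆ range n) : up K ⊆ range (n + 1) := by
  intro x hx
  obtain ⟨y, hy, rfl⟩ := mem_up.1 hx
  have := mem_range.1 (h hy)
  exact mem_range.2 (by omega)

open Classical in
/-- Splitting a family of subsets of `range (n + 1)` according to whether they contain zero. -/
lemma card_filter_powersetCard_succ (n s : ℕ) (P : Finset ℕ → Prop) :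
    (((range (n + 1)).powersetCard (s + 1)).filter P).card =
      (((range n).powersetCard (s + 1)).filter fun K => P (up K)).card +
      (((range n).powersetCard s).filter fun K => P (insert 0 (up K))).card := by
  rw [← card_filter_add_card_filter_not (p := fun K => 0 ∉ K)]
  congr 1
  · symm
    refine card_nbij up (fun K hK => ?_) up_injective.injOn (fun K hK => ?_)
    · simp only [mem_coe, mem_filter, mem_powersetCard] at hK ⊢
      exact ⟨⟨⟨up_subset_range hK.1.1, by rw [card_up, hK.1.2]⟩, hK.2⟩, zero_notMem_up K⟩
    · simp only [mem_coe, mem_filter, mem_powersetCard] at hK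
      obtain ⟨K', h1, rfl⟩ := exists_up_eq hK.2 hK.1.1.1
      refine ⟨K', ?_, rfl⟩
      simp only [mem_coe, mem_filter, mem_powersetCard]
      exact ⟨⟨h1, by rw [← card_up, hK.1.1.2]⟩, hK.1.2⟩
  · symm
    refine card_nbij (fun K => insert 0 (up K)) (fun K hK => ?_) (fun K _ K' _ h => ?_)
      (fun K hK => ?_)
    · simp only [mem_coe, mem_filter, mem_powersetCard] at hK ⊢
      refine ⟨⟨⟨insert_subset (by simp) (up_subset_range hK.1.1), ?_⟩, hK.2⟩, by simp⟩
      rw [card_insert_of_notMem (zero_notMem_up K), card_up, hK.1.2]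
    · simp only at h
      apply up_injective
      rw [← erase_insert (zero_notMem_up K), h, erase_insert (zero_notMem_up K')]
    · simp only [mem_coe, mem_filter, mem_powersetCard, not_not] at hK
      obtain ⟨K', h1, h2⟩ := exists_up_eq (notMem_erase 0 K) ((erase_subset _ _).trans hK.1.1.1)
      have h3 : insert 0 (up K') = K := by rw [h2, insert_erase hK.2]
      refine ⟨K', ?_, h3⟩
      simp only [mem_coe, mem_filter, mem_powersetCard]
      refine ⟨⟨h1, ?_⟩, by rw [h3]; exact hK.1.2⟩
      rw [← card_up, h2, card_erase_of_mem hK.2, hK.1.1.2, Nat.add_sub_cancel]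

/-- Pascal's rule for the extremal count, matching the split of the cliques by whether they contain
0. -/
lemma card_heavy_succ (n s p q : ℕ) : (heavy (n + 1) (s + 1) (p + 1) (q + 1)).card =
    (heavy n (s + 1) p (q + 1)).card + (heavy n s p q).card := by
  have := card_filter_powersetCard_succ n s fun K => q + 1 ≤ cnt K (p + 1)
  simp only [cnt_up, cnt_insert_zero_up, Nat.add_le_add_iff_right] at this
  unfold heavy
  convert this

/-- The members of `H` without zero, translated down by one. -/
def down (H : Set (Finset ℕ)) : Set (Finset ℕ) := {E | up E ∈ H}

lemma downClosed_down {H : Set (Finset ℕ)} (hD : DownClosed H) : DownClosed (down H) := by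
  intro E hE E' hc hcnt
  refine hD _ hE _ (by rw [card_up, card_up, hc]) fun m => ?_
  rcases m with _ | m
  · simp [cnt]
  · rw [cnt_up, cnt_up]; exact hcnt m

/-- k + 1 disjoint edges avoiding 0 can be compressed into the vertices 1, ..., r(k + 1). They then
miss the far edge through 0, which makes a matching of k + 2 edges. -/
lemma matchFree_down {r k : ℕ} {H : Set (Finset ℕ)} (hD : DownClosed H)
    (hM : MatchFree (k + 1) H) (hH : ∀ E ∈ H, E.card = r)
    (hfar : insert 0 (Ico (r * (k + 1) + 1) (r * (k + 1) + r)) ∈ H) : MatchFree k (down H) := by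
  intro f hf hd
  set U := (range (k + 1)).biUnion fun i => up (f i) with hU
  have hUsub : ∀ i ≤ k, up (f i) ⊆ U := fun i hi =>
    subset_biUnion_of_mem (fun i => up (f i)) (mem_range.2 (by omega))
  have hUc : U.card ≤ r * (k + 1) := by
    refine card_biUnion_le.trans ((sum_le_card_nsmul _ _ r fun i hi => ?_).trans ?_)
    · exact (hH _ (hf i (by rw [mem_range] at hi; omega))).le
    · rw [card_range, smul_eq_mul, mul_comm]
  have hU0 : 0 ∉ U := by simp [hU, zero_notMem_up]
  -- The rank within U, starting at 1 so that vertex 0 stays free. It is injective on U and never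
  -- moves a point of U up.
  let φ : ℕ → ℕ := fun x => 1 + cnt U x
  have hmono : ∀ x ∈ U, ∀ y, x < y → φ x < φ y := fun x hx y hxy => by
    refine Nat.add_lt_add_left (card_lt_card ⟨fun z hz => ?_, fun h => ?_⟩) 1
    · rw [mem_filter] at hz ⊢; exact ⟨hz.1, by omega⟩
    · have := mem_filter.1 (h (mem_filter.2 ⟨hx, hxy⟩))
      omega
  have hinj : ∀ x ∈ U, ∀ y ∈ U, φ x = φ y → x = y := fun x hx y hy h => by
    rcases lt_trichotomy x y with h1 | h1 | h1
    · have := hmono x hx y h1; omega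
    · exact h1
    · have := hmono y hy x h1; omega
  have hle : ∀ x ∈ U, φ x ≤ x := fun x hx => by
    have hx0 : x ≠ 0 := fun h => hU0 (h ▸ hx)
    have : cnt U x ≤ (Ico 1 x).card := card_le_card fun z hz => by
      rw [mem_filter] at hz
      have hz0 : z ≠ 0 := fun h => hU0 (h ▸ hz.1)
      rw [mem_Ico]; omega
    rw [Nat.card_Ico] at this
    simp only [φ]; omega
  have hup : ∀ x ∈ U, φ x ≤ r * (k + 1) := fun x hx => by
    have : cnt U x < U.card := card_lt_card ⟨filter_subset _ _, fun h => by
      have := mem_filter.1 (h hx); omega⟩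
    simp only [φ]; omega
  have hmem : ∀ i ≤ k, (up (f i)).image φ ∈ H := fun i hi => by
    have hinj' : Set.InjOn φ (up (f i) : Set ℕ) := fun x hx y hy h =>
      hinj x (hUsub i hi hx) y (hUsub i hi hy) h
    refine hD _ (hf i hi) _ (card_image_of_injOn hinj') fun m => ?_
    rw [cnt, ← card_image_of_injOn (hinj'.mono (fun x hx => (mem_filter.1 hx).1))]
    refine card_le_card fun y hy => ?_
    obtain ⟨x, hx, rfl⟩ := mem_image.1 hy
    rw [mem_filter] at hx ⊢
    exact ⟨mem_image_of_mem φ hx.1, (hle x (hUsub i hi hx.1)).trans_lt hx.2⟩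
  have hcross : ∀ i ≤ k, Disjoint ((up (f i)).image φ)
      (insert 0 (Ico (r * (k + 1) + 1) (r * (k + 1) + r))) := fun i hi => by
    rw [Finset.disjoint_left]
    intro y hy hy'
    obtain ⟨x, hx, rfl⟩ := mem_image.1 hy
    have h1 := hup x (hUsub i hi hx)
    have h2 : 1 ≤ φ x := Nat.le_add_right 1 _
    rw [mem_insert, mem_Ico] at hy'
    omega
  refine hM (fun i => if i ≤ k then (up (f i)).image φ else
    insert 0 (Ico (r * (k + 1) + 1) (r * (k + 1) + r))) (fun i hi => ?_) (fun i hi j hj hij => ?_)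
  · by_cases h : i ≤ k
    · simp only [h, if_true]; exact hmem i h
    · simp only [h, if_false]; exact hfar
  · by_cases h : i ≤ k
    · by_cases h' : j ≤ k
      · simp only [h, h', if_true]
        rw [Finset.disjoint_left]
        intro y hy hy'
        obtain ⟨x, hx, rfl⟩ := mem_image.1 hy
        obtain ⟨x', hx', he⟩ := mem_image.1 hy'
        obtain rfl := hinj _ (hUsub j h' hx') _ (hUsub i h hx) he
        exact Finset.disjoint_left.1 ((Finset.disjoint_map _).2 (hd i h j h' hij)) hx hx'
      · simp only [h, h', if_true, if_false]; exact hcross i h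
    · have h' : j ≤ k := by omega
      simp only [h, h', if_true, if_false]; exact (hcross j h').symm

/-- The clique bound for small cliques, for down-closed families. -/
lemma card_cl_le_of_small {r : ℕ} (hr : 1 ≤ r) {k t n : ℕ} {H : Set (Finset ℕ)}
    (htk : t + 1 ≤ k) (hD : DownClosed H) (hM : MatchFree k H) (hH : ∀ E ∈ H, E.card = r)
    (hn : 4 * (Real.exp 1 * (r : ℝ)) ^ (t + 2) * (k : ℝ) ≤ n) :
    (cl r n (t + r) H).card ≤ (heavy n (t + r) k (t + 1)).card := by
  induction k generalizing t n H with
  | zero => omega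
  | succ k ih =>
  rcases Nat.eq_or_lt_of_le htk with htk' | htk'
  · obtain rfl : t = k := by omega
    -- Here t is the last core vertex, so this is the edge W of `le_cnt_of_far_mem` for a = 1.
    by_cases hfar : insert t (Ico (r * (t + 1) + 1) (r * (t + 1) + r)) ∈ H
    · refine card_le_card fun K hK => ?_
      obtain ⟨h1, h2, h3⟩ := mem_cl.1 hK
      refine mem_heavy.2 ⟨h1, h2, ?_⟩
      have hW : Ico (1 * (t + 1) - 1) (1 * (t + 1) + 1 - 1) ∪
          Ico (r * (t + 1) + 1) (r * (t + 1) + r) ∈ H := by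
        rw [show 1 * (t + 1) - 1 = t by omega, show 1 * (t + 1) + 1 - 1 = t + 1 by omega,
          Nat.Ico_succ_singleton, ← insert_eq]
        exact hfar
      have := le_cnt_of_far_mem le_rfl hr (by omega) hD hM hW h2 h3
      rwa [show 1 * (t + 1) + 1 - 1 = t + 1 by omega] at this
    · exact card_cl_le_of_far_notMem hr htk hD hM le_rfl hfar hn
  by_cases hfar : insert 0 (Ico (r * (k + 1) + 1) (r * (k + 1) + r)) ∈ H
  swap
  · exact card_cl_le_of_far_notMem hr htk hD hM (Nat.zero_le t) hfar hn
  obtain ⟨he1, -⟩ := exp_one_bounds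
  have hr1 : (1 : ℝ) ≤ r := by exact_mod_cast hr
  have her : 1 ≤ Real.exp 1 * (r : ℝ) := by nlinarith
  have hX : 1 ≤ (Real.exp 1 * (r : ℝ)) ^ (t + 2) := one_le_pow₀ her
  have hk0 : (0 : ℝ) ≤ k := by positivity
  push_cast at hn
  obtain ⟨n, rfl⟩ : ∃ n', n = n' + 1 := by
    refine ⟨n - 1, ?_⟩
    have : (0 : ℝ) < n := lt_of_lt_of_le (by positivity) hn
    have : 0 < n := by exact_mod_cast this
    omega
  have hn' : 4 * (Real.exp 1 * (r : ℝ)) ^ (t + 2) * (k : ℝ) ≤ n := by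
    push_cast at hn
    nlinarith
  have hD' := downClosed_down hD
  have hM' := matchFree_down hD hM hH hfar
  have hH' : ∀ E ∈ down H, E.card = r := fun E hE => by rw [← card_up]; exact hH _ hE
  have hs : t + r = (t + r - 1) + 1 := by omega
  have hsplit := card_filter_powersetCard_succ n (t + r - 1) fun K => ∀ E ⊆ K, E.card = r → E ∈ H
  rw [← hs] at hsplit
  have hcl : (cl r (n + 1) (t + r) H).card = _ := Eq.trans (by unfold cl; congr!) hsplit
  have hheavy := card_heavy_succ n (t + r - 1) k t
  rw [← hs] at hheavy
  rw [hcl, hheavy]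
  refine Nat.add_le_add (le_trans (card_le_card fun K hK => ?_) (ih (by omega) hD' hM' hH' hn')) ?_
  · simp only [mem_filter, mem_powersetCard] at hK
    exact mem_cl.2 ⟨hK.1.1, hK.1.2, fun E hE hEr =>
      hK.2 _ (up_subset.2 hE) (by rw [card_up, hEr])⟩
  -- Cliques through 0 leave cliques with t lowered by one. For t = 0 no bound is needed: the
  -- heaviness condition is empty.
  · rcases t with _ | t
    · refine card_le_card fun K hK => ?_
      simp only [mem_filter, mem_powersetCard] at hK
      exact mem_heavy.2 ⟨hK.1.1, hK.1.2, Nat.zero_le _⟩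
    · rw [show t + 1 + r - 1 = t + r by omega]
      refine le_trans (card_le_card fun K hK => ?_)
        (ih (t := t) (by omega) hD' hM' hH' (le_trans ?_ hn'))
      · simp only [mem_filter, mem_powersetCard] at hK
        exact mem_cl.2 ⟨hK.1.1, hK.1.2, fun E hE hEr =>
          hK.2 _ ((up_subset.2 hE).trans (subset_insert _ _)) (by rw [card_up, hEr])⟩
      · have := pow_le_pow_right₀ her (show t + 2 ≤ t + 1 + 2 by omega)
        gcongr

/-! ### Removing the down-closed assumption and returning to vertex sets -/

lemma card_cl_le_of_downClosed {r n s k N : ℕ}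
    (h : ∀ H : Set (Finset ℕ), DownClosed H → MatchFree k H → (∀ E ∈ H, E.card = r) →
      (cl r n s H).card ≤ N) (H : Finset (Finset ℕ)) :
    MatchFree k (H : Set (Finset ℕ)) → (∀ E ∈ H, E.card = r) → (cl r n s H).card ≤ N := by
  induction H using shift_induction with
  | h₀ H hS => exact fun hM hH => h _ hS.downClosed hM hH
  | h₁ H i j hij ih =>
    exact fun hM hH => (card_cl_le_shift hij H).trans (ih (matchFree_shift hM) (card_of_mem_shift hH))

/-- A family of vertex sets, transported to the naturals. -/
def transport {V : Type*} (ι : V ↪ ℕ) (H : Finset (Finset V)) : Finset (Finset ℕ) := H.image (·.map ι)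

lemma mem_transport {V : Type*} {ι : V ↪ ℕ} {H : Finset (Finset V)} {E : Finset V} :
    E.map ι ∈ transport ι H ↔ E ∈ H := by
  simp [transport]

lemma exists_map_eq {V : Type*} [Fintype V] {n : ℕ} {ι : V ↪ ℕ} (hn : Fintype.card V = n)
    (hι : ∀ v, ι v < n) {K : Finset ℕ} (hK : K ⊆ range n) : ∃ K' : Finset V, K'.map ι = K := by
  have huniv : (univ : Finset V).map ι = range n := by
    refine eq_of_subset_of_card_le (fun x hx => ?_) (by rw [card_map, card_univ, hn, card_range])
    obtain ⟨v, -, rfl⟩ := mem_map.1 hx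
    exact mem_range.2 (hι v)
  refine ⟨univ.filter (ι · ∈ K), ?_⟩
  ext x
  simp only [mem_map, mem_filter, mem_univ, true_and]
  constructor
  · rintro ⟨v, hv, rfl⟩; exact hv
  · intro hx
    have := hK hx
    rw [← huniv] at this
    obtain ⟨v, -, rfl⟩ := mem_map.1 this
    exact ⟨v, hx, rfl⟩

lemma cliqueCount_eq_card_cl {V : Type*} [Fintype V] [DecidableEq V] {n : ℕ} {ι : V ↪ ℕ}
    (hn : Fintype.card V = n) (hι : ∀ v, ι v < n) (r s : ℕ) (H : Finset (Finset V)) :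
    cliqueCount r s H = (cl r n s (transport ι H)).card := by
  have hrange : ∀ K : Finset V, K.map ι ⊆ range n := fun K x hx => by
    obtain ⟨v, -, rfl⟩ := mem_map.1 hx
    exact mem_range.2 (hι v)
  refine card_nbij (·.map ι) (fun K hK => ?_) (map_injective ι).injOn (fun K hK => ?_)
  · simp only [cliques, mem_coe, mem_filter, mem_powersetCard] at hK
    rw [mem_coe, mem_cl]
    refine ⟨hrange K, by rw [card_map, hK.1.2], fun E hE hEr => ?_⟩
    obtain ⟨E', hE', rfl⟩ := subset_map_iff.1 hE
    rw [mem_coe, mem_transport]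
    exact hK.2 (mem_powersetCard.2 ⟨hE', by rw [← hEr, card_map]⟩)
  · obtain ⟨h1, h2, h3⟩ := mem_cl.1 hK
    obtain ⟨K', rfl⟩ := exists_map_eq hn hι h1
    refine ⟨K', ?_, rfl⟩
    simp only [cliques, mem_coe, mem_filter, mem_powersetCard]
    refine ⟨⟨subset_univ _, by rw [← h2, card_map]⟩, fun E hE => ?_⟩
    obtain ⟨hE1, hE2⟩ := mem_powersetCard.1 hE
    exact mem_transport.1 (h3 _ (map_subset_map.2 hE1) (by rw [card_map, hE2]))

lemma card_of_mem_transport {V : Type*} {ι : V ↪ ℕ} {r : ℕ} {H : Finset (Finset V)}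
    (hH : (H : Set (Finset V)).Sized r) : ∀ E ∈ transport ι H, E.card = r := by
  intro E hE
  obtain ⟨F, hF, rfl⟩ := mem_image.1 hE
  rw [card_map]; exact hH hF

/-- As r ≥ 1, edges are nonempty, so disjoint edges with different indices are distinct and do form
a matching of size k + 1. -/
lemma matchFree_transport {V : Type*} [DecidableEq V] {ι : V ↪ ℕ} {r k : ℕ} (hr : 1 ≤ r)
    {H : Finset (Finset V)}
    (hH : (H : Set (Finset V)).Sized r) (hk : matchingNumber H ≤ k) :
    MatchFree k (transport ι H : Set (Finset ℕ)) := by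
  intro f hf hd
  have hex : ∀ i, ∃ F : Finset V, i ≤ k → F ∈ H ∧ F.map ι = f i := fun i => by
    by_cases hi : i ≤ k
    · obtain ⟨F, hF, h⟩ := mem_image.1 (mem_coe.1 (hf i hi))
      exact ⟨F, fun _ => ⟨hF, h⟩⟩
    · exact ⟨∅, fun h => absurd h hi⟩
  choose g hg using hex
  have hgd : ∀ i ≤ k, ∀ j ≤ k, i ≠ j → Disjoint (g i) (g j) := fun i hi j hj hij => by
    have := hd i hi j hj hij
    rwa [← (hg i hi).2, ← (hg j hj).2, Finset.disjoint_map] at this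
  have hinj : Set.InjOn g (range (k + 1) : Set ℕ) := fun i hi j hj h => by
    simp only [coe_range, Set.mem_Iio] at hi hj
    by_contra hij
    have h1 := hgd i (by omega) j (by omega) hij
    rw [← h, disjoint_self_iff_empty] at h1
    have h2 := hH (hg i (by omega)).1
    rw [h1, card_empty] at h2
    omega
  have hmem : (range (k + 1)).image g ∈
      H.powerset.filter fun M => ∀ A ∈ M, ∀ B ∈ M, A ≠ B → Disjoint A B := by
    rw [mem_filter, mem_powerset]
    refine ⟨fun A hA => ?_, fun A hA B hB hAB => ?_⟩
    · obtain ⟨i, hi, rfl⟩ := mem_image.1 hA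
      exact (hg i (by rw [mem_range] at hi; omega)).1
    · obtain ⟨i, hi, rfl⟩ := mem_image.1 hA
      obtain ⟨j, hj, rfl⟩ := mem_image.1 hB
      rw [mem_range] at hi hj
      exact hgd i (by omega) j (by omega) fun h => hAB (by rw [h])
  have h1 := le_sup (f := Finset.card) hmem
  rw [card_image_of_injOn hinj, card_range] at h1
  have h2 : k + 1 ≤ matchingNumber H := h1
  omega

lemma matchingNumber_le {V : Type*} [DecidableEq V] {H : Finset (Finset V)} {k : ℕ}
    (h : ∀ M ⊆ H, (∀ A ∈ M, ∀ B ∈ M, A ≠ B → Disjoint A B) → M.card ≤ k) :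
    matchingNumber H ≤ k :=
  Finset.sup_le fun M hM => h M (mem_powerset.1 (mem_filter.1 hM).1) (mem_filter.1 hM).2

/-- Disjoint edges use at least a core vertices each, and k + 1 of them would need one more than the
core has. -/
lemma matchingNumber_extremal_le {r n k a : ℕ} (ha : 1 ≤ a) :
    matchingNumber (extremal r n k a) ≤ k := by
  refine matchingNumber_le fun M hsub hd => ?_
  let core : Finset (Fin n) → Finset (Fin n) := fun F => F.filter fun i => i.val < a * k + a - 1
  have h1 : M.card * a ≤ (M.biUnion core).card := by
    rw [card_biUnion fun A hA B hB hAB => disjoint_filter_filter (hd A hA B hB hAB)]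
    refine card_nsmul_le_sum M _ a fun A hA => ?_
    exact (mem_filter.1 (hsub hA)).2
  have h2 : (M.biUnion core).card ≤ a * k + a - 1 := by
    rw [← card_range (a * k + a - 1)]
    refine card_le_card_of_injOn Fin.val (fun x hx => ?_) Fin.val_injective.injOn
    obtain ⟨A, -, hxA⟩ := mem_biUnion.1 hx
    exact mem_coe.2 (mem_range.2 (mem_filter.1 hxA).2)
  by_contra hcon
  have h3 : (k + 1) * a ≤ M.card * a := Nat.mul_le_mul_right _ (by omega)
  have h4 : (k + 1) * a = a * k + a := by ring
  omega

lemma extremal_sized (r n k a : ℕ) : (extremal r n k a : Set (Finset (Fin n))).Sized r := by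
  intro F hF
  exact (mem_powersetCard.1 (mem_filter.1 (mem_coe.1 hF)).1).2

/-- An r-subset omits t vertices of the s-set, so at least a of its t + a core vertices remain. -/
lemma card_heavy_le_cliqueCount_extremal (r n k a t : ℕ) :
    (heavy n (t + r) (a * k + a - 1) (t + a)).card ≤ cliqueCount r (t + r) (extremal r n k a) := by
  rw [cliqueCount_eq_card_cl (ι := Fin.valEmbedding) (Fintype.card_fin n) fun v => v.isLt]
  refine card_le_card fun K hK => ?_
  obtain ⟨h1, h2, h3⟩ := mem_heavy.1 hK
  refine mem_cl.2 ⟨h1, h2, fun E hE hEr => ?_⟩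
  obtain ⟨F, rfl⟩ := exists_map_eq (ι := Fin.valEmbedding) (Fintype.card_fin n) (fun v => v.isLt)
    (hE.trans h1)
  rw [mem_coe, mem_transport, extremal, mem_filter, mem_powersetCard]
  rw [card_map] at hEr
  refine ⟨⟨subset_univ _, hEr⟩, ?_⟩
  have h4 := cnt_le_cnt_of_card hE (a * k + a - 1)
  rw [cnt, cnt, filter_map, card_map, card_map, hEr, h2] at h4
  have h5 : t + a ≤ (K.filter (· < a * k + a - 1)).card := h3
  have h6 : (F.filter ((· < a * k + a - 1) ∘ Fin.valEmbedding)).card =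
      (F.filter fun i => i.val < a * k + a - 1).card := rfl
  omega

lemma cliqueCount_le_choose_of_large {V : Type*} [Fintype V] [DecidableEq V] {n k r t : ℕ}
    (hr : 1 ≤ r) (hn : Fintype.card V = n) (H : Finset (Finset V))
    (hH : (H : Set (Finset V)).Sized r) (hk : matchingNumber H ≤ k) (ht : (r - 1) * k ≤ t) :
    cliqueCount r (t + r) H ≤ (r * k + r - 1).choose (t + r) := by
  obtain ⟨e⟩ : Nonempty (V ≃ Fin n) := ⟨Fintype.equivFinOfCardEq hn⟩
  rw [cliqueCount_eq_card_cl (ι := e.toEmbedding.trans Fin.valEmbedding) hn fun v => (e v).isLt]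
  exact card_cl_le_of_large ht _ (matchFree_transport hr hH hk)

end CliqueMatching

/-! ### The theorem -/

open CliqueMatching in
theorem theorem1p3 {V : Type*} [Fintype V] [DecidableEq V] (n k r s : ℕ) (hr : 1 ≤ r)
    (hn : Fintype.card V = n) (H : Finset (Finset V)) (hH : (H : Set (Finset V)).Sized r)
    (hk : CliqueMatching.matchingNumber H ≤ k) :
    -- the comparison hypergraphs are themselves admissible
    (∀ a : ℕ, 1 ≤ a → a ≤ r →
      CliqueMatching.matchingNumber (CliqueMatching.extremal r n k a) ≤ k) ∧
    -- (I)
    (r ≤ s → s ≤ k + r - 1 →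
      4 * (Real.exp 1 * (r : ℝ)) ^ (s - r + 2) * (k : ℝ) ≤ (n : ℝ) →
      CliqueMatching.cliqueCount r s H
        ≤ CliqueMatching.cliqueCount r s (CliqueMatching.extremal r n k 1)) ∧
    -- (II)
    (∀ a : ℕ, a = (s - r) / k + 1 →
      k + r ≤ s → s ≤ (r - 1) * (k + 1) →
      4 * (r : ℝ) ^ 2 * (k : ℝ) * (Real.exp 1 * (r : ℝ) / ((a : ℝ) - 1)) ^ (s - r + a)
        ≤ (n : ℝ) →
      CliqueMatching.cliqueCount r s H
        ≤ CliqueMatching.cliqueCount r s (CliqueMatching.extremal r n k a)) ∧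
    -- (III)
    ((r - 1) * k + r ≤ s → s ≤ r * k + r - 1 → r * k + r - 1 ≤ n →
      CliqueMatching.cliqueCount r s H
          ≤ CliqueMatching.cliqueCount r s (CliqueMatching.extremal r n k r) ∧
        (CliqueMatching.cliqueCount r s H
            < CliqueMatching.cliqueCount r s (CliqueMatching.extremal r n k r) →
          (CliqueMatching.cliqueCount r s H : ℤ)
            ≤ ((r * k + r - 1).choose s : ℤ) - ((r * k - 1).choose (s - r) : ℤ))) := by
  obtain ⟨e⟩ : Nonempty (V ≃ Fin n) := ⟨Fintype.equivFinOfCardEq hn⟩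
  have hcount : ∀ s, cliqueCount r s H =
      (cl r n s (transport (e.toEmbedding.trans Fin.valEmbedding) H)).card := fun s =>
    cliqueCount_eq_card_cl hn (fun v => (e v).isLt) r s H
  have hM := matchFree_transport (ι := e.toEmbedding.trans Fin.valEmbedding) hr hH hk
  have hS := card_of_mem_transport (ι := e.toEmbedding.trans Fin.valEmbedding) hH
  refine ⟨fun a ha _ => matchingNumber_extremal_le ha, fun h1 h2 h3 => ?_,
    fun a ha h1 h2 h3 => ?_, fun h1 h2 h3 => ?_⟩
  · obtain ⟨t, rfl⟩ : ∃ t, s = t + r := ⟨s - r, by omega⟩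
    rw [Nat.add_sub_cancel] at h3
    refine le_trans ?_ (card_heavy_le_cliqueCount_extremal r n k 1 t)
    rw [hcount, show 1 * k + 1 - 1 = k by omega]
    exact card_cl_le_of_downClosed
      (fun H hD hM hS => card_cl_le_of_small hr (by omega) hD hM hS h3) _ hM hS
  · obtain ⟨t, rfl⟩ : ∃ t, s = t + r := ⟨s - r, by omega⟩
    rw [Nat.add_sub_cancel] at h3 ha
    have hmul : (r - 1) * (k + 1) = (r - 1) * k + (r - 1) := by ring
    -- For k = 0 the range for s is empty, so the division by k is a genuine one.
    have hk1 : 1 ≤ k := by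
      by_contra h
      obtain rfl : k = 0 := by omega
      omega
    have hq1 : 1 ≤ t / k := (Nat.one_le_div_iff hk1).2 (by omega)
    have hq2 : t / k < r - 1 := (Nat.div_lt_iff_lt_mul hk1).2 (by omega)
    have hq3 := Nat.div_mul_le_self t k
    have hq4 : t < a * k := by
      rw [ha, ← Nat.div_lt_iff_lt_mul hk1]; omega
    refine le_trans ?_ (card_heavy_le_cliqueCount_extremal r n k a t)
    rw [hcount]
    refine card_cl_le_of_downClosed (fun H hD hM _ => card_cl_le_of_medium hk1 (by omega) (by omega)
      ?_ hq4 hD hM h3) _ hM hS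
    rwa [ha, Nat.add_sub_cancel]
  · obtain ⟨t, rfl⟩ : ∃ t, s = t + r := ⟨s - r, by omega⟩
    rw [Nat.add_sub_cancel]
    have ht : (r - 1) * k ≤ t := by omega
    have hmax : (r * k + r - 1).choose (t + r) ≤ cliqueCount r (t + r) (extremal r n k r) := by
      refine le_trans ?_ (card_heavy_le_cliqueCount_extremal r n k r t)
      rw [← Finset.card_range (r * k + r - 1), ← Finset.card_powersetCard, Finset.card_range]
      refine Finset.card_le_card fun K hK => ?_
      rw [Finset.mem_powersetCard] at hK
      refine mem_heavy.2 ⟨hK.1.trans (Finset.range_subset_range.2 h3), hK.2, ?_⟩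
      have := card_le_cnt_add hK.1 (r * k + r - 1)
      omega
    have hle := cliqueCount_le_choose_of_large hr hn H hH hk ht
    refine ⟨hle.trans hmax, fun hlt => ?_⟩
    -- The extremal graph obeys the same upper bound, so a count strictly below it is strictly below
    -- the binomial.
    have hext := cliqueCount_le_choose_of_large hr (Fintype.card_fin n) _ (extremal_sized r n k r)
      (matchingNumber_extremal_le hr) ht
    have hlt' := hlt.trans_le hext
    rw [hcount] at hlt' ⊢
    have := card_cl_add_le_of_lt hr ht (by omega) _ (fun E hE => ?_) hM hlt'
    · have h4 : (((cl r n (t + r) (transport (e.toEmbedding.trans Fin.valEmbedding) H)).card +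
        (r * k - 1).choose t : ℕ) : ℤ) ≤ ((r * k + r - 1).choose (t + r) : ℕ) := by exact_mod_cast this
      push_cast at h4
      linarith
    · obtain ⟨F, -, rfl⟩ := Finset.mem_image.1 hE
      intro x hx
      obtain ⟨v, -, rfl⟩ := Finset.mem_map.1 hx
      exact Finset.mem_range.2 (e v).isLt
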